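/- Let $\mathbb{H}_1=\mathbb{R}^3$ be the three-dimensional Heisenberg group with product $(x,y,z)\cdot(x',y',z')=\bigl(x+x',\,y+y',\,z+z'+\tfrac12(xy'-x'y)\bigr)$ and the left-invariant Korányi metric $d(p,q)=N(p^{-1}q)$, where $N(x,y,z)=\bigl((x^2+y^2)^2+z^2\bigr)^{1/4}$. Let $G_1$ be the graph with 10 vertices and 10 edges that consists of a cycle of length 8 together with two pendant edges attached at two antipodal vertices of the cycle; the two vertices of degree one are its source and its sink (they are at distance 6). The Laakso graphs are defined as follows: $G_0$ is a single edge, and $G_n$ is obtained from $G_{n-1}$ by replacing each edge with a copy of $G_1$, the source and the sink of the copy being identified with the two endpoints of the edge. The vertex set of $G_n$ carries the path metric with edges of length one (so the diameter of $G_n$ is $6^n$), and $|G_n|$ denotes the number of vertices of $G_n$. A metric space $X$ embeds into a metric space $Y$ with distortion $D\ge 1$ if there are $f:X\to Y$ and $s>0$ with $s\,d_X(u,v)\le d_Y(f(u),f(v))\le D\,s\,d_X(u,v)$ for all $u,v\in X$. **Theorem.** The Laakso graphs $G_n$ embed into $\mathbb{H}_1$ with distortion $O\bigl((\log|G_n|)^{1/4}\sqrt{\log\log|G_n|}\bigr)$,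 equivalently $O\bigl(n^{1/4}\sqrt{\log n}\bigr)$. That is, there is a constant $C>0$ such that for every $n\ge 1$ the graph $G_n$ embeds into $\mathbb{H}_1$ with distortion $C(\log|G_n|)^{1/4}\sqrt{\log\log|G_n|}$; and there is a constant $C>0$ such that for every $n\ge 2$ the graph $G_n$ embeds into $\mathbb{H}_1$ with distortion $C\,n^{1/4}\sqrt{\log n}$. -/

import Mathlib

/-! ### The Heisenberg group `ℍ₁` with the Korányi metric -/

/-- The underlying set `ℝ × ℝ × ℝ` of the three-dimensional Heisenberg group. -/
@[ext]
structure Heisenberg where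
  x : ℝ
  y : ℝ
  z : ℝ

namespace Heisenberg

/-- The group law `(x,y,z)(x',y',z') = (x+x', y+y', z+z'+(xy'-x'y)/2)`. -/
noncomputable instance : Mul Heisenberg :=
  ⟨fun p q => ⟨p.x + q.x, p.y + q.y, p.z + q.z + (1 / 2) * (p.x * q.y - q.x * p.y)⟩⟩

instance : One Heisenberg := ⟨⟨0, 0, 0⟩⟩

instance : Inv Heisenberg := ⟨fun p => ⟨-p.x, -p.y, -p.z⟩⟩

@[simp] theorem mul_x (p q : Heisenberg) : (p * q).x = p.x + q.x := rfl
@[simp] theorem mul_y (p q : Heisenberg) : (p * q).y = p.y + q.y := rfl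
@[simp] theorem mul_z (p q : Heisenberg) :
    (p * q).z = p.z + q.z + (1 / 2) * (p.x * q.y - q.x * p.y) := rfl
@[simp] theorem one_x : (1 : Heisenberg).x = 0 := rfl
@[simp] theorem one_y : (1 : Heisenberg).y = 0 := rfl
@[simp] theorem one_z : (1 : Heisenberg).z = 0 := rfl
@[simp] theorem inv_x (p : Heisenberg) : p⁻¹.x = -p.x := rfl
@[simp] theorem inv_y (p : Heisenberg) : p⁻¹.y = -p.y := rfl
@[simp] theorem inv_z (p : Heisenberg) : p⁻¹.z = -p.z := rfl

noncomputable instance : Group Heisenberg :=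
  Group.ofLeftAxioms
    (fun p q r => by ext <;> simp <;> ring)
    (fun p => by ext <;> simp)
    (fun p => by ext <;> simp)

/-- The Korányi norm `N(x,y,z) = ((x²+y²)² + z²)^{1/4}`. -/
noncomputable def koranyi (p : Heisenberg) : ℝ :=
  ((p.x ^ 2 + p.y ^ 2) ^ 2 + p.z ^ 2) ^ (1 / 4 : ℝ)

theorem koranyi_nonneg (p : Heisenberg) : 0 ≤ koranyi p := by
  unfold koranyi; positivity

theorem koranyi_pow_four (p : Heisenberg) :
    koranyi p ^ 4 = (p.x ^ 2 + p.y ^ 2) ^ 2 + p.z ^ 2 := by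
  unfold koranyi
  rw [← Real.rpow_natCast, ← Real.rpow_mul (by positivity)]
  norm_num

theorem koranyi_one : koranyi 1 = 0 := by
  simp [koranyi]

theorem koranyi_inv (p : Heisenberg) : koranyi p⁻¹ = koranyi p := by
  simp [koranyi]

theorem eq_one_of_koranyi_eq_zero {p : Heisenberg} (h : koranyi p = 0) : p = 1 := by
  have h4 := koranyi_pow_four p
  rw [h] at h4
  have hz : p.z ^ 2 = 0 := by nlinarith [sq_nonneg p.z, sq_nonneg (p.x ^ 2 + p.y ^ 2)]
  have hr : (p.x ^ 2 + p.y ^ 2) ^ 2 = 0 := by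
    nlinarith [sq_nonneg p.z, sq_nonneg (p.x ^ 2 + p.y ^ 2)]
  have hr' : p.x ^ 2 + p.y ^ 2 = 0 := pow_eq_zero_iff (two_ne_zero) |>.1 hr
  have hx : p.x ^ 2 = 0 := by nlinarith [sq_nonneg p.x, sq_nonneg p.y]
  have hy : p.y ^ 2 = 0 := by nlinarith [sq_nonneg p.x, sq_nonneg p.y]
  ext
  · simpa using hx
  · simpa using hy
  · simpa using hz

/-- The triangle inequality for the Korányi norm. -/
theorem koranyi_mul_le (p q : Heisenberg) : koranyi (p * q) ≤ koranyi p + koranyi q := by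
  have hp := koranyi_nonneg p
  have hq := koranyi_nonneg q
  -- `N(p)² = |w(p)|` for the complex number `w(p) = x² + y² + i z`
  have key : ∀ r : Heisenberg, ‖(⟨r.x ^ 2 + r.y ^ 2, r.z⟩ : ℂ)‖ = koranyi r ^ 2 := by
    intro r
    have h0 : ‖(⟨r.x ^ 2 + r.y ^ 2, r.z⟩ : ℂ)‖ ^ 2 = (koranyi r ^ 2) ^ 2 := by
      rw [Complex.sq_norm, Complex.normSq_mk, ← pow_mul, koranyi_pow_four]
      ring
    exact (pow_left_inj₀ (norm_nonneg _) (by positivity) two_ne_zero).1 h0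
  have hrad : ∀ r : Heisenberg, r.x ^ 2 + r.y ^ 2 ≤ koranyi r ^ 2 := by
    intro r
    rw [← key r]
    exact Complex.re_le_norm (⟨r.x ^ 2 + r.y ^ 2, r.z⟩ : ℂ)
  set e : ℂ := ⟨2 * (p.x * q.x + p.y * q.y), (1 / 2) * (p.x * q.y - q.x * p.y)⟩ with he
  have hsum : (⟨(p * q).x ^ 2 + (p * q).y ^ 2, (p * q).z⟩ : ℂ)
      = ⟨p.x ^ 2 + p.y ^ 2, p.z⟩ + ⟨q.x ^ 2 + q.y ^ 2, q.z⟩ + e := by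
    apply Complex.ext
    · simp [he]; ring
    · simp [he]
  have hE : ‖e‖ ≤ 2 * koranyi p * koranyi q := by
    apply le_of_sq_le_sq _ (by positivity)
    have h1 : ‖e‖ ^ 2 ≤ 4 * ((p.x ^ 2 + p.y ^ 2) * (q.x ^ 2 + q.y ^ 2)) := by
      rw [Complex.sq_norm, he, Complex.normSq_mk]
      nlinarith [sq_nonneg (p.x * q.y - q.x * p.y)]
    have h2 : (p.x ^ 2 + p.y ^ 2) * (q.x ^ 2 + q.y ^ 2) ≤ koranyi p ^ 2 * koranyi q ^ 2 :=
      mul_le_mul (hrad p) (hrad q) (by positivity) (by positivity)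
    nlinarith
  have hN : koranyi (p * q) ^ 2 ≤ (koranyi p + koranyi q) ^ 2 := by
    rw [← key (p * q), hsum]
    calc _ ≤ ‖(⟨p.x ^ 2 + p.y ^ 2, p.z⟩ : ℂ)‖ + ‖(⟨q.x ^ 2 + q.y ^ 2, q.z⟩ : ℂ)‖ + ‖e‖ :=
          norm_add₃_le
      _ ≤ koranyi p ^ 2 + koranyi q ^ 2 + 2 * koranyi p * koranyi q := by
          rw [key p, key q]; linarith
      _ = _ := by ring
  exact le_of_sq_le_sq hN (by positivity)

/-- The left-invariant Korányi metric `d(p,q) = N(p⁻¹q)`. -/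
noncomputable instance : MetricSpace Heisenberg where
  dist p q := koranyi (p⁻¹ * q)
  dist_self p := by
    rw [inv_mul_cancel, koranyi_one]
  dist_comm p q := by
    rw [← koranyi_inv, mul_inv_rev, inv_inv]
  dist_triangle p q r := by
    have h : p⁻¹ * r = (p⁻¹ * q) * (q⁻¹ * r) := by group
    rw [h]
    exact koranyi_mul_le _ _
  eq_of_dist_eq_zero := by
    intro p q h
    exact (inv_mul_eq_one.1 (eq_one_of_koranyi_eq_zero h))

end Heisenberg

/-! ### Laakso graphs -/

/-- A directed multigraph. The orientation only serves to say how a graph with a source and a sink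
is substituted for an edge. -/
structure DirGraph where
  V : Type
  E : Type
  tail : E → V
  head : E → V

/-- The underlying undirected simple graph. -/
def DirGraph.toSimpleGraph (G : DirGraph) : SimpleGraph G.V :=
  SimpleGraph.fromRel fun u v => ∃ e : G.E, G.tail e = u ∧ G.head e = v

/-- The eight vertices of `G₁` other than its source and its sink: the two fork points, and the
three vertices inside each of the two arms (`true` is the top, `false` is the bottom). -/
inductive LaaksoInner
  | forkLeft
  | forkRight
  | arm (side : Bool) (i : Fin 3)

/-- The ten vertices of `G₁`. -/
inductive LaaksoNode
  | source
  | sink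
  | inner (v : LaaksoInner)

/-- The ten edges of `G₁`: an edge from the source to the left fork point, the four edges of each
of the two arms, and an edge from the right fork point to the sink. -/
inductive LaaksoStep
  | first
  | last
  | arm (side : Bool) (i : Fin 4)

/-- The `i`-th vertex, `i = 0, …, 4`, on an arm from the left to the right fork point. -/
def LaaksoInner.onArm (side : Bool) : Fin 5 → LaaksoInner :=
  ![forkLeft, arm side 0, arm side 1, arm side 2, forkRight]

/-- The starting vertex of an edge of `G₁`. -/
def LaaksoStep.tail : LaaksoStep → LaaksoNode
  | first => .source
  | last => .inner .forkRight
  | arm side i => .inner (.onArm side i.castSucc)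

/-- The end vertex of an edge of `G₁`. -/
def LaaksoStep.head : LaaksoStep → LaaksoNode
  | first => .inner .forkLeft
  | last => .sink
  | arm side i => .inner (.onArm side i.succ)

/-- The vertex corresponding to a vertex of `G₁` in the copy of `G₁` that replaces the edge `e`:
the source and the sink become the endpoints of `e`, the inner vertices are new. -/
def DirGraph.place (G : DirGraph) (e : G.E) : LaaksoNode → G.V ⊕ (G.E × LaaksoInner)
  | .source => Sum.inl (G.tail e)
  | .sink => Sum.inl (G.head e)
  | .inner v => Sum.inr (e, v)

/-- The graph obtained by replacing every edge of `G` by a copy of `G₁`. -/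
def DirGraph.subst (G : DirGraph) : DirGraph where
  V := G.V ⊕ (G.E × LaaksoInner)
  E := G.E × LaaksoStep
  tail p := G.place p.1 p.2.tail
  head p := G.place p.1 p.2.head

/-- The Laakso graphs: `G₀` is a single edge, and `Gₙ₊₁` is obtained from `Gₙ` by replacing every
edge by a copy of `G₁`. -/
def laaksoGraph : ℕ → DirGraph
  | 0 => { V := Bool, E := Unit, tail := fun _ => false, head := fun _ => true }
  | n + 1 => (laaksoGraph n).subst

theorem DirGraph.reachable_edge (G : DirGraph) (e : G.E) :
    G.toSimpleGraph.Reachable (G.tail e) (G.head e) := by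
  by_cases h : G.tail e = G.head e
  · rw [h]
  · refine SimpleGraph.Adj.reachable ?_
    rw [DirGraph.toSimpleGraph, SimpleGraph.fromRel_adj]
    exact ⟨h, Or.inl ⟨e, rfl, rfl⟩⟩

theorem DirGraph.reachable_place (G : DirGraph) (e : G.E) (v : LaaksoNode) :
    G.subst.toSimpleGraph.Reachable (G.place e .source) (G.place e v) := by
  have step : ∀ s : LaaksoStep,
      G.subst.toSimpleGraph.Reachable (G.place e s.tail) (G.place e s.head) :=
    fun s => G.subst.reachable_edge (e, s)
  have h1 := step .first
  have harm : ∀ (b : Bool) (k : Fin 5), G.subst.toSimpleGraph.Reachable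
      (G.place e .source) (G.place e (.inner (.onArm b k))) := by
    intro b k
    induction k using Fin.induction with
    | zero => exact h1
    | succ i ih => exact ih.trans (step (.arm b i))
  have hfr := harm true 4
  match v with
  | .source => exact SimpleGraph.Reachable.refl _
  | .sink => exact hfr.trans (step .last)
  | .inner .forkLeft => exact h1
  | .inner .forkRight => exact hfr
  | .inner (.arm b i) =>
    have := harm b i.succ.castSucc
    fin_cases i <;> exact this

theorem DirGraph.preconnected_subst (G : DirGraph) (h : G.toSimpleGraph.Preconnected) :
    G.subst.toSimpleGraph.Preconnected := by
  have hadj : ∀ u v : G.V, G.toSimpleGraph.Adj u v →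
      G.subst.toSimpleGraph.Reachable (Sum.inl u) (Sum.inl v) := by
    intro u v huv
    rw [DirGraph.toSimpleGraph, SimpleGraph.fromRel_adj] at huv
    obtain ⟨-, ⟨e, rfl, rfl⟩ | ⟨e, rfl, rfl⟩⟩ := huv
    · exact G.reachable_place e .sink
    · exact (G.reachable_place e .sink).symm
  have hold : ∀ u v : G.V, G.subst.toSimpleGraph.Reachable (Sum.inl u) (Sum.inl v) := by
    intro u v
    obtain ⟨w⟩ := h u v
    induction w with
    | nil => exact SimpleGraph.Reachable.refl _
    | cons huv _ ih => exact (hadj _ _ huv).trans ih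
  have hbase : ∀ x : G.subst.V, ∃ u : G.V, G.subst.toSimpleGraph.Reachable (Sum.inl u) x := by
    rintro (u | ⟨e, v⟩)
    · exact ⟨u, SimpleGraph.Reachable.refl _⟩
    · exact ⟨G.tail e, G.reachable_place e (.inner v)⟩
  intro x y
  obtain ⟨u, hu⟩ := hbase x
  obtain ⟨v, hv⟩ := hbase y
  exact hu.symm.trans ((hold u v).trans hv)

/-- The vertices of the Laakso graph `Gₙ`. -/
def LaaksoVertex (n : ℕ) : Type := (laaksoGraph n).V

/-- The Laakso graph `Gₙ` as an undirected graph. -/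
def laaksoSimpleGraph (n : ℕ) : SimpleGraph (LaaksoVertex n) := (laaksoGraph n).toSimpleGraph

theorem laaksoSimpleGraph_connected (n : ℕ) : (laaksoSimpleGraph n).Connected := by
  have hpre : (laaksoGraph n).toSimpleGraph.Preconnected := by
    induction n with
    | zero =>
      have h : (laaksoGraph 0).toSimpleGraph.Reachable false true :=
        (laaksoGraph 0).reachable_edge ()
      intro u v
      change Bool at u v
      cases u <;> cases v
      · exact SimpleGraph.Reachable.refl _
      · exact h
      · exact h.symm
      · exact SimpleGraph.Reachable.refl _
    | succ n ih => exact (laaksoGraph n).preconnected_subst ih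
  have hne : Nonempty (laaksoGraph n).V := by
    clear hpre
    induction n with
    | zero => exact ⟨false⟩
    | succ n ih => exact ih.map Sum.inl
  exact (SimpleGraph.connected_iff _).2 ⟨hpre, hne⟩

/-- The vertex set of `Gₙ` with the path metric in which every edge has length one. -/
noncomputable instance (n : ℕ) : MetricSpace (LaaksoVertex n) where
  dist u v := ((laaksoSimpleGraph n).dist u v : ℝ)
  dist_self u := by simp
  dist_comm u v := by rw [SimpleGraph.dist_comm]
  dist_triangle u v w := by
    exact_mod_cast (laaksoSimpleGraph_connected n).dist_triangle
  eq_of_dist_eq_zero := by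
    intro u v h
    exact (laaksoSimpleGraph_connected n).dist_eq_zero_iff.1 (by exact_mod_cast h)

/-! ### Distortion -/

/-- `X` embeds into `Y` with distortion `D ≥ 1`: there are a map `f : X → Y` and a scale `s > 0`
with `s d(u,v) ≤ d(f u, f v) ≤ D s d(u,v)` for all `u, v`. -/
def EmbedsWithDistortion (X Y : Type*) [MetricSpace X] [MetricSpace Y] (D : ℝ) : Prop :=
  1 ≤ D ∧ ∃ f : X → Y, ∃ s : ℝ, 0 < s ∧
    ∀ u v : X, s * dist u v ≤ dist (f u) (f v) ∧ dist (f u) (f v) ≤ D * s * dist u v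

/-! A horizontal curve in `ℍ₁` is determined by its starting point and its planar projection, and
the vertical coordinate records the area `∫ y dx`. Replace the unit segment by the projection of
`G₁` in which one arm has the slopes `θ, -θ, -θ, θ` and the other is its mirror image. Each arm has
total area zero, so the two lifts meet again at the right fork. In between, their areas have
opposite signs and size about `θ r²` at distance `r` from the nearer fork. The Korányi norm sees
area through a square root, so opposite points are about `√θ r` apart, although their projections
may coincide.

Iterate this inside every edge by similarities. An edge is stretched by at most `√(1 + θ²)` per
level, so the map is Lipschitz with constant `(1 + θ²)^(n/2)` in normalised units
(`dist_laaksoPos_le`). The lower bound loses a factor of order `√θ` only once, at the coarsest level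
where two points lie in different copies (`dist_le_dist_laaksoPos`): points on opposite arms are
separated by area (`NearArm.le_dist`), points on consecutive parts by `x` (`NearSegment.le_dist`).
Both rest on `NearSegment.arm`: the finer levels perturb positions and areas by less than the main
terms.

With `θ` of order `n^(-1/2)` the stretch stays bounded and the distortion is `O(θ^(-1/2)) =
O(n^(1/4))`. This is stronger than the claim, whose logarithmic factor is bounded below by a
positive constant. -/

open Heisenberg

/-! ### Similarities and areas in the Heisenberg group. -/

namespace Heisenberg

/-- The similarity of the Heisenberg group that acts on the plane as multiplication by `m`. -/
noncomputable def sim (m : ℂ) (p : Heisenberg) : Heisenberg :=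
  ⟨m.re * p.x - m.im * p.y, m.im * p.x + m.re * p.y, Complex.normSq m * p.z⟩

theorem sim_one (m : ℂ) : sim m 1 = 1 := by
  ext <;> simp [sim]

theorem one_sim (p : Heisenberg) : sim 1 p = p := by
  ext <;> simp [sim]

theorem sim_mul (m : ℂ) (p q : Heisenberg) : sim m (p * q) = sim m p * sim m q := by
  ext <;> simp [sim, Complex.normSq_apply] <;> ring

theorem sim_inv (m : ℂ) (p : Heisenberg) : sim m p⁻¹ = (sim m p)⁻¹ := by
  ext <;> simp [sim] <;> ring

theorem sim_sim (m m' : ℂ) (p : Heisenberg) : sim m (sim m' p) = sim (m * m') p := by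
  ext <;> simp [sim, Complex.normSq_apply] <;> ring

theorem koranyi_sim (m : ℂ) (p : Heisenberg) : koranyi (sim m p) = ‖m‖ * koranyi p := by
  have h : koranyi (sim m p) ^ 4 = (‖m‖ * koranyi p) ^ 4 := by
    have hm : ‖m‖ ^ 4 = Complex.normSq m ^ 2 := by rw [Complex.normSq_eq_norm_sq]; ring
    rw [mul_pow, koranyi_pow_four, koranyi_pow_four, hm]
    simp only [sim, Complex.normSq_apply]
    ring
  exact (pow_left_inj₀ (koranyi_nonneg _)
    (mul_nonneg (norm_nonneg _) (koranyi_nonneg _)) (by norm_num)).1 h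

theorem dist_def (p q : Heisenberg) : dist p q = koranyi (p⁻¹ * q) := rfl

theorem dist_mul_left' (a p q : Heisenberg) : dist (a * p) (a * q) = dist p q := by
  rw [dist_def, dist_def]; congr 1; group

theorem dist_sim (m : ℂ) (p q : Heisenberg) : dist (sim m p) (sim m q) = ‖m‖ * dist p q := by
  rw [dist_def, dist_def, ← sim_inv, ← sim_mul, koranyi_sim]

/-- The end point of the unit horizontal segment that leaves the identity along the `x`-axis. -/
def unitX : Heisenberg := ⟨1, 0, 0⟩

theorem koranyi_unitX : koranyi unitX = 1 := by
  simp [koranyi, unitX]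

/-- The area `∫ y dx` under the horizontal paths that lead from the identity to `p`. -/
noncomputable def area (p : Heisenberg) : ℝ := p.x * p.y / 2 - p.z

theorem abs_x_sub_le_dist (p q : Heisenberg) : |q.x - p.x| ≤ dist p q := by
  have h := koranyi_pow_four (p⁻¹ * q)
  rw [← dist_def] at h
  have h0 : 0 ≤ dist p q := dist_nonneg
  refine le_of_pow_le_pow_left₀ (n := 4) (by norm_num) h0 ?_
  rw [h, (by decide : Even 4).pow_abs]
  simp only [mul_x, inv_x, mul_y, inv_y]
  rw [show -p.x + q.x = q.x - p.x by ring]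
  nlinarith [sq_nonneg (p⁻¹ * q).z, sq_nonneg ((q.x - p.x) * (-p.y + q.y)),
    sq_nonneg ((-p.y + q.y) ^ 2)]

/-- The vertical coordinate of `p⁻¹ * q` is the difference of the areas, corrected by the trapezoid
under the segment between the projections. That coordinate is at most the squared distance. -/
theorem area_sub_area_le (p q : Heisenberg) :
    area p - area q ≤ dist p q ^ 2 + dist p q * |p.y + q.y| / 2 := by
  have h := koranyi_pow_four (p⁻¹ * q)
  rw [← dist_def] at h
  have h0 : 0 ≤ dist p q := dist_nonneg
  have hz : (p⁻¹ * q).z = area p - area q + (q.x - p.x) * (p.y + q.y) / 2 := by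
    simp [area]; ring
  have hz2 : |(p⁻¹ * q).z| ≤ dist p q ^ 2 := by
    refine abs_le_of_sq_le_sq ?_ (by positivity)
    nlinarith [sq_nonneg ((p⁻¹ * q).x ^ 2 + (p⁻¹ * q).y ^ 2)]
  have hx := abs_x_sub_le_dist p q
  have h2 : |(q.x - p.x) * (p.y + q.y)| ≤ dist p q * |p.y + q.y| := by
    rw [abs_mul]; gcongr
  have h3 := (abs_le.1 hz2).2
  have h4 := (abs_le.1 h2).1
  linarith

end Heisenberg

/-! ### The basic embedding of `G₁`. -/

namespace LaaksoNode

/-- The normalised distance to the source in `G₁`. -/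
noncomputable def height : LaaksoNode → ℝ
  | source => 0
  | sink => 1
  | inner .forkLeft => 1 / 6
  | inner .forkRight => 5 / 6
  | inner (.arm _ i) => ![2 / 6, 3 / 6, 4 / 6] i

/-- The image of a vertex of `G₁` under the basic embedding with slope `θ`. -/
noncomputable def pos (θ : ℝ) : LaaksoNode → Heisenberg
  | source => 1
  | sink => unitX
  | inner .forkLeft => ⟨1 / 6, 0, 0⟩
  | inner .forkRight => ⟨5 / 6, 0, 0⟩
  | inner (.arm b i) =>
    ![⟨2 / 6, (bif b then θ else -θ) / 6, (bif b then θ else -θ) / 72⟩,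
      ⟨3 / 6, 0, -(bif b then θ else -θ) / 36⟩,
      ⟨4 / 6, -(bif b then θ else -θ) / 6, -5 * (bif b then θ else -θ) / 72⟩] i

end LaaksoNode

namespace LaaksoStep

/-- The planar vector of an edge of `G₁` under the basic embedding with slope `θ`. -/
noncomputable def vec (θ : ℝ) : LaaksoStep → ℂ
  | first => ⟨1 / 6, 0⟩
  | last => ⟨1 / 6, 0⟩
  | arm b i => ⟨1 / 6, (bif b then θ else -θ) * ![1, -1, -1, 1] i / 6⟩

/-- The edges at the right fork contain the closing condition: both zigzags enclose zero area, so
their lifts end at the same point. -/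
theorem pos_head (θ : ℝ) (s : LaaksoStep) :
    s.head.pos θ = s.tail.pos θ * sim (s.vec θ) unitX := by
  rcases s with _ | _ | ⟨b, i⟩
  · ext <;> simp [head, tail, LaaksoNode.pos, sim, vec, unitX]
  · ext <;> norm_num [head, tail, LaaksoNode.pos, sim, vec, unitX, LaaksoInner.onArm]
  · fin_cases i <;> cases b <;> ext <;>
      simp [head, tail, LaaksoNode.pos, sim, vec, unitX, LaaksoInner.onArm] <;> ring

theorem height_head (s : LaaksoStep) : s.head.height = s.tail.height + 1 / 6 := by
  rcases s with _ | _ | ⟨b, i⟩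
  · norm_num [head, tail, LaaksoNode.height, LaaksoInner.onArm]
  · norm_num [head, tail, LaaksoNode.height, LaaksoInner.onArm]
  · fin_cases i <;> simp [head, tail, LaaksoNode.height, LaaksoInner.onArm] <;> norm_num

theorem re_vec (θ : ℝ) (s : LaaksoStep) : (s.vec θ).re = 1 / 6 := by
  rcases s with _ | _ | ⟨b, i⟩ <;> rfl

theorem norm_vec_ge (θ : ℝ) (s : LaaksoStep) : 1 / 6 ≤ ‖s.vec θ‖ := by
  rw [← re_vec θ s]; exact Complex.re_le_norm _

theorem abs_im_vec_le {θ : ℝ} (hθ : 0 ≤ θ) (s : LaaksoStep) : |(s.vec θ).im| ≤ θ / 6 := by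
  rcases s with _ | _ | ⟨b, i⟩
  · simp [vec]; positivity
  · simp [vec]; positivity
  · fin_cases i <;> cases b <;> simp [vec, abs_div, abs_of_nonneg hθ]

theorem norm_vec_le {θ : ℝ} (hθ : 0 ≤ θ) (s : LaaksoStep) :
    ‖s.vec θ‖ ≤ Real.sqrt (1 + θ ^ 2) / 6 := by
  rw [le_div_iff₀ (by norm_num)]
  apply Real.le_sqrt_of_sq_le
  rw [mul_pow, Complex.sq_norm, Complex.normSq_apply, re_vec]
  have h := abs_le.1 (abs_im_vec_le hθ s)
  nlinarith

theorem pos_tail_x (θ : ℝ) (s : LaaksoStep) : (s.tail.pos θ).x = s.tail.height := by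
  rcases s with _ | _ | ⟨b, i⟩
  · simp [tail, LaaksoNode.pos, LaaksoNode.height]
  · simp [tail, LaaksoNode.pos, LaaksoNode.height]
  · fin_cases i <;> simp [tail, LaaksoNode.pos, LaaksoNode.height, LaaksoInner.onArm]

end LaaksoStep

/-! ### Position and area estimates, propagated to the next level. -/

/-- The estimates for a point at height `h` of an embedded Laakso graph: the deviation from the
segment is at most linear, and the area quadratic, in the distance to the nearer end point. -/
structure NearSegment (θ h : ℝ) (p : Heisenberg) : Prop where
  nonneg : 0 ≤ h
  le_one : h ≤ 1
  x_left : |p.x - h| ≤ 5 * θ * h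
  x_right : |p.x - h| ≤ 5 * θ * (1 - h)
  y_left : |p.y| ≤ 5 * θ * h
  y_right : |p.y| ≤ 5 * θ * (1 - h)
  area_left : |area p| ≤ 3 / 10 * θ * h ^ 2
  area_right : |area p| ≤ 3 / 10 * θ * (1 - h) ^ 2

/-- The estimates for a point at height `h` on the arm with sign `ε` of an embedded Laakso graph,
in terms of the distance to the nearer fork. -/
structure NearArm (ε θ h : ℝ) (p : Heisenberg) : Prop where
  ge : 1 / 6 ≤ h
  le : h ≤ 5 / 6
  x_left : |p.x - h| ≤ 7 * θ * (h - 1 / 6)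
  x_right : |p.x - h| ≤ 7 * θ * (5 / 6 - h)
  y_left : |p.y| ≤ 7 * θ * (h - 1 / 6)
  y_right : |p.y| ≤ 7 * θ * (5 / 6 - h)
  area_ge : h ≤ 1 / 2 → 1 / 10 * θ * (h - 1 / 6) ^ 2 ≤ ε * area p
  area_ge' : 1 / 2 ≤ h → 1 / 10 * θ * (5 / 6 - h) ^ 2 ≤ ε * area p
  area_le : ε * area p ≤ 3 / 10 * θ * h ^ 2
  area_le' : ε * area p ≤ 3 / 10 * θ * (1 - h) ^ 2

theorem nearSegment_one {θ : ℝ} (hθ : 0 ≤ θ) : NearSegment θ 0 1 := by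
  constructor <;> simp [area] <;> positivity

theorem nearSegment_unitX {θ : ℝ} (hθ : 0 ≤ θ) : NearSegment θ 1 unitX := by
  constructor <;> simp [area, unitX] <;> positivity

/-- The six times dilated coordinates of a point on the arm with sign `ε`. -/
theorem arm_coordinates {ε θ : ℝ} {b : Bool} (hb : (bif b then θ else -θ) = ε * θ)
    (hε : ε * ε = 1) (i : Fin 4) (p : Heisenberg) :
    let q := (LaaksoStep.arm b i).tail.pos θ * sim ((LaaksoStep.arm b i).vec θ) p
    let e : ℝ := ![1, -1, -1, 1] i
    6 * q.x = (i : ℝ) + 1 + p.x - e * θ * (ε * p.y) ∧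
    6 * (ε * q.y) = ![0, 1, 0, -1] i * θ + ε * p.y + e * θ * p.x ∧
    36 * (ε * area q) = ![0, 1 / 2, 1, 1 / 2] i * θ +
      (p.x - e * θ * (ε * p.y)) * (![0, 1, 0, -1] i * θ) + (1 + θ ^ 2) * (ε * area p) +
      e * θ * (p.x ^ 2 - (ε * p.y) ^ 2) / 2 - θ ^ 2 * p.x * (ε * p.y) := by
  have h2 : ε ^ 2 = 1 := by rw [sq, hε]
  have h3 : ε ^ 3 = ε := by rw [pow_succ, h2, one_mul]
  fin_cases i <;>
  · simp [LaaksoStep.tail, LaaksoStep.vec, LaaksoNode.pos, LaaksoInner.onArm, sim, area, hb,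
      Complex.normSq_apply]
    refine ⟨?_, ?_, ?_⟩ <;> ring_nf <;> (try rw [h2]) <;> (try rw [h3]) <;> ring

/-- The bracket is the area that the slope of an edge contributes, divided by `θ`. It is the
triangle area `u² / 2` up to a small relative error. -/
theorem quadratic_bracket {u ξ β κ : ℝ} (hu : 0 ≤ u) (hξ : |ξ - u| ≤ u / 200)
    (hβ : |β| ≤ u / 200) (hκ : |κ| ≤ 1 / 1000) :
    49 / 100 * u ^ 2 ≤ (ξ ^ 2 - β ^ 2) / 2 - κ * (ξ * β) ∧
      (ξ ^ 2 - β ^ 2) / 2 - κ * (ξ * β) ≤ 51 / 100 * u ^ 2 := by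
  obtain ⟨h1, h2⟩ := abs_le.1 hξ
  have hξ0 : 0 ≤ ξ := by linarith
  have hlo : (199 / 200 * u) ^ 2 ≤ ξ ^ 2 := by gcongr; linarith
  have hhi : ξ ^ 2 ≤ (201 / 200 * u) ^ 2 := by gcongr; linarith
  have hβ2 : β ^ 2 ≤ (u / 200) ^ 2 := by rw [← sq_abs]; gcongr
  have hp : |κ * (ξ * β)| ≤ 1 / 1000 * (201 / 200 * u * (u / 200)) := by
    rw [abs_mul, abs_mul, abs_of_nonneg hξ0]
    gcongr
    linarith
  have hp' := abs_le.1 hp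
  constructor <;> nlinarith [sq_nonneg β]

/-- In units of `1 / 36`, the slope next to a fork creates area about `θ h² / 2`, while the copy on
the edge changes it by at most about `3 / 10 * θ * h ^ 2`; the remainder exceeds `1 / 10 * θ * h ^
2`. For the deviations, the constant 7 leaves room for 5 from the copy and about 1 from the slope.
-/
theorem NearSegment.arm {ε θ h : ℝ} {p : Heisenberg} {b : Bool} (hθ : 0 < θ) (hθ1 : θ ≤ 1 / 1000)
    (hb : (bif b then θ else -θ) = ε * θ) (hε : ε = 1 ∨ ε = -1) (i : Fin 4)
    (hp : NearSegment θ h p) :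
    NearArm ε θ (((i : ℝ) + 1 + h) / 6)
      ((LaaksoStep.arm b i).tail.pos θ * sim ((LaaksoStep.arm b i).vec θ) p) := by
  have hεε : ε * ε = 1 := by rcases hε with rfl | rfl <;> norm_num
  have habs : ∀ r : ℝ, |ε * r| = |r| := by
    intro r; rcases hε with rfl | rfl <;> simp
  obtain ⟨hx, hy, hS⟩ := arm_coordinates hb hεε i p
  set q := (LaaksoStep.arm b i).tail.pos θ * sim ((LaaksoStep.arm b i).vec θ) p
  obtain ⟨h0, h1, x1, x2, y1, y2, a1, a2⟩ := hp
  rw [← habs] at y1 y2 a1 a2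
  generalize ε * p.y = β at *
  generalize ε * area p = s at *
  generalize p.x = ξ at *
  have hθh : θ * h ≤ 1 / 1000 * h := by gcongr
  have hθh' : θ * (1 - h) ≤ 1 / 1000 * (1 - h) := by gcongr
  have hθh0 : 0 ≤ θ * h := by positivity
  have hθh1 : 0 ≤ θ * (1 - h) := mul_nonneg hθ.le (by linarith)
  have x1' : |ξ - h| ≤ h / 200 := by linarith
  have x2' : |(1 - ξ) - (1 - h)| ≤ (1 - h) / 200 := by
    rw [show (1 - ξ) - (1 - h) = -(ξ - h) by ring, abs_neg]; linarith
  have y1' : |β| ≤ h / 200 := by linarith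
  have y2' : |β| ≤ (1 - h) / 200 := by linarith
  have hκ : |θ| ≤ 1 / 1000 := by rwa [abs_of_pos hθ]
  have hκ' : |-θ| ≤ 1 / 1000 := by rwa [abs_neg]
  have ts : ∀ c : ℝ, |s| ≤ c → |(1 + θ ^ 2) * s| ≤ 1001 / 1000 * c := by
    intro c hc
    rw [abs_mul, abs_of_pos (by positivity : 0 < 1 + θ ^ 2)]
    gcongr
    nlinarith
  have s1 := abs_le.1 (ts _ a1)
  have s2 := abs_le.1 (ts _ a2)
  have tβ1 : |θ * β| ≤ 1 / 1000 * (5 * θ * h) := by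
    rw [abs_mul, abs_of_pos hθ]; gcongr
  have tβ2 : |θ * β| ≤ 1 / 1000 * (5 * θ * (1 - h)) := by
    rw [abs_mul, abs_of_pos hθ]; gcongr
  have tx1 : |θ * (ξ - h)| ≤ θ * (h / 200) := by
    rw [abs_mul, abs_of_pos hθ]; gcongr
  have tx2 : |θ * (ξ - h)| ≤ θ * ((1 - h) / 200) := by
    rw [abs_mul, abs_of_pos hθ]; gcongr
    rw [show ξ - h = -((1 - ξ) - (1 - h)) by ring, abs_neg]; exact x2'
  have hxq : ∀ c, |6 * q.x - 6 * (((i : ℝ) + 1 + h) / 6)| ≤ 6 * c →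
      |q.x - ((i : ℝ) + 1 + h) / 6| ≤ c := by
    intro c hc
    rw [← mul_sub, abs_mul, abs_of_pos (by norm_num : (0 : ℝ) < 6)] at hc
    linarith only [hc]
  have hyq : ∀ c, |6 * (ε * q.y)| ≤ 6 * c → |q.y| ≤ c := by
    intro c hc
    rw [abs_mul, habs, abs_of_pos (by norm_num : (0 : ℝ) < 6)] at hc
    linarith only [hc]
  have Q1 := quadratic_bracket h0 x1' y1' hκ
  have Q2 := quadratic_bracket h0 x1' y1' hκ'
  have Q3 := quadratic_bracket (by linarith) x2' y2' hκ
  have Q4 := quadratic_bracket (by linarith) x2' y2' hκ'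
  rw [abs_le] at x1 x2 y1 y2 tβ1 tβ2 tx1 tx2
  clear x1' x2' y1' y2' hκ hκ' ts hθh hθh' a1 a2
  have up : ∀ {B C : ℝ}, B ≤ C → θ * B ≤ θ * C := fun h => mul_le_mul_of_nonneg_left h hθ.le
  have hh : 0 ≤ h * (1 - h) := mul_nonneg h0 (by linarith only [h1])
  have hθhh : 0 ≤ θ * (h * (1 - h)) := mul_nonneg hθ.le hh
  have hsq : 0 ≤ θ * h ^ 2 := by positivity
  have hsq' : 0 ≤ θ * (1 - h) ^ 2 := by positivity
  fin_cases i
  · simp only [Fin.zero_eta, Matrix.cons_val_zero, Nat.cast_zero] at hx hy hS hxq ⊢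
    have hS' : 36 * (ε * area q) =
        θ * ((ξ ^ 2 - β ^ 2) / 2 - θ * (ξ * β)) + (1 + θ ^ 2) * s := by rw [hS]; ring
    have L := up Q1.1
    have U := up Q1.2
    constructor
    · linarith only [h0]
    · linarith only [h1]
    · apply hxq; rw [hx, abs_le]; constructor <;> linarith only [x1, tβ1, hθh0]
    · apply hxq; rw [hx, abs_le]; constructor <;> linarith only [x1, tβ1, hθh0, hθh1]
    · apply hyq; rw [hy, abs_le]; constructor <;> linarith only [y1, tx1, hθh0]
    · apply hyq; rw [hy, abs_le]; constructor <;> linarith only [y1, tx1, hθh0, hθh1]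
    · intro _; linarith only [hS', L, s1, hsq]
    · intro hc; linarith only [hc, h1]
    · linarith only [hS', U, s1, hsq, hθhh, hsq']
    · linarith only [hS', U, s1, hsq, hθhh, hsq']
  · simp only [Fin.mk_one, Fin.isValue, Nat.cast_one, Matrix.cons_val] at hx hy hS hxq ⊢
    -- Here the area is expanded about the right end of the edge, the middle of the arm, where it is
    -- largest.
    have hS' : 36 * (ε * area q) =
        θ * (1 - (((1 - ξ) ^ 2 - β ^ 2) / 2 - θ * ((1 - ξ) * β))) + (1 + θ ^ 2) * s := by
      rw [hS]; ring
    have L := up Q3.1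
    have U := up Q3.2
    constructor
    · linarith only [h0]
    · linarith only [h1]
    · apply hxq; rw [hx, abs_le]
      constructor <;> linarith only [hθ, x1, x2, y1, y2, tβ1, tβ2, tx1, tx2, hθh0, hθh1]
    · apply hxq; rw [hx, abs_le]
      constructor <;> linarith only [hθ, x1, x2, y1, y2, tβ1, tβ2, tx1, tx2, hθh0, hθh1]
    · apply hyq; rw [hy, abs_le]
      constructor <;> linarith only [hθ, x1, x2, y1, y2, tβ1, tβ2, tx1, tx2, hθh0, hθh1]
    · apply hyq; rw [hy, abs_le]
      constructor <;> linarith only [hθ, x1, x2, y1, y2, tβ1, tβ2, tx1, tx2, hθh0, hθh1]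
    · intro _; linarith only [hθ, hS', L, U, s1, s2, hsq, hsq', hθhh, hθh0, hθh1]
    · intro hc
      -- This edge reaches the right half of the arm only in its end point.
      obtain rfl : h = 1 := by linarith only [hc, h1]
      linarith only [hθ, hS', L, U, s1, s2, hsq, hsq', hθhh, hθh0, hθh1]
    · linarith only [hθ, hS', L, U, s1, s2, hsq, hsq', hθhh, hθh0, hθh1]
    · linarith only [hθ, hS', L, U, s1, s2, hsq, hsq', hθhh, hθh0, hθh1]
  · simp only [Fin.reduceFinMk, Nat.cast_ofNat, Matrix.cons_val] at hx hy hS hxq ⊢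
    have hS' : 36 * (ε * area q) =
        θ * (1 - ((ξ ^ 2 - β ^ 2) / 2 - -θ * (ξ * β))) + (1 + θ ^ 2) * s := by
      rw [hS]; ring
    have L := up Q2.1
    have U := up Q2.2
    constructor
    · linarith only [h0]
    · linarith only [h1]
    · apply hxq; rw [hx, abs_le]
      constructor <;> linarith only [hθ, x1, x2, y1, y2, tβ1, tβ2, tx1, tx2, hθh0, hθh1]
    · apply hxq; rw [hx, abs_le]
      constructor <;> linarith only [hθ, x1, x2, y1, y2, tβ1, tβ2, tx1, tx2, hθh0, hθh1]
    · apply hyq; rw [hy, abs_le]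
      constructor <;> linarith only [hθ, x1, x2, y1, y2, tβ1, tβ2, tx1, tx2, hθh0, hθh1]
    · apply hyq; rw [hy, abs_le]
      constructor <;> linarith only [hθ, x1, x2, y1, y2, tβ1, tβ2, tx1, tx2, hθh0, hθh1]
    · intro hc
      obtain rfl : h = 0 := by linarith only [hc, h0]
      linarith only [hθ, hS', L, U, s1, s2, hsq, hsq', hθhh, hθh0, hθh1]
    · intro _; linarith only [hθ, hS', L, U, s1, s2, hsq, hsq', hθhh, hθh0, hθh1]
    · linarith only [hθ, hS', L, U, s1, s2, hsq, hsq', hθhh, hθh0, hθh1]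
    · linarith only [hθ, hS', L, U, s1, s2, hsq, hsq', hθhh, hθh0, hθh1]
  · simp only [Fin.reduceFinMk, Nat.cast_ofNat, Matrix.cons_val] at hx hy hS hxq ⊢
    have hS' : 36 * (ε * area q) =
        θ * (((1 - ξ) ^ 2 - β ^ 2) / 2 - -θ * ((1 - ξ) * β)) + (1 + θ ^ 2) * s := by
      rw [hS]; ring
    have L := up Q4.1
    have U := up Q4.2
    constructor
    · linarith only [h0]
    · linarith only [h1]
    · apply hxq; rw [hx, abs_le]
      constructor <;> linarith only [hθ, x1, x2, y1, y2, tβ1, tβ2, tx1, tx2, hθh0, hθh1]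
    · apply hxq; rw [hx, abs_le]
      constructor <;> linarith only [hθ, x1, x2, y1, y2, tβ1, tβ2, tx1, tx2, hθh0, hθh1]
    · apply hyq; rw [hy, abs_le]
      constructor <;> linarith only [hθ, x1, x2, y1, y2, tβ1, tβ2, tx1, tx2, hθh0, hθh1]
    · apply hyq; rw [hy, abs_le]
      constructor <;> linarith only [hθ, x1, x2, y1, y2, tβ1, tβ2, tx1, tx2, hθh0, hθh1]
    · intro hc; linarith only [hc, h0]
    · intro _; linarith only [hθ, hS', L, U, s1, s2, hsq, hsq', hθhh, hθh0, hθh1]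
    · linarith only [hθ, hS', L, U, s1, s2, hsq, hsq', hθhh, hθh0, hθh1]
    · linarith only [hθ, hS', L, U, s1, s2, hsq, hsq', hθhh, hθh0, hθh1]

/-- The constants close up: `7 * (h - 1/6) ≤ 5 * h` for `h ≤ 7/12`, and `7 * (5/6 - h) ≤ 5 * h` for
`h ≥ 35/72`, so splitting at `1/2` works; the bounds at the right end are symmetric. -/
theorem NearArm.nearSegment {ε θ h : ℝ} {p : Heisenberg} (hθ : 0 < θ) (hε : ε = 1 ∨ ε = -1)
    (hp : NearArm ε θ h p) : NearSegment θ h p := by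
  obtain ⟨ge, le, x1, x2, y1, y2, a1, a2, a3, a4⟩ := hp
  have habs : |area p| = ε * area p := by
    have h0 : 0 ≤ ε * area p := by
      rcases le_total h (1 / 2) with h | h
      · exact le_trans (by positivity) (a1 h)
      · exact le_trans (by positivity) (a2 h)
    rw [← abs_of_nonneg h0]
    rcases hε with rfl | rfl <;> simp
  have k1 : 0 ≤ θ * (h - 1 / 6) := mul_nonneg hθ.le (by linarith)
  have k2 : 0 ≤ θ * (5 / 6 - h) := mul_nonneg hθ.le (by linarith)
  constructor
  · linarith
  · linarith
  iterate 4 rcases le_total h (1 / 2) with h | h <;> nlinarith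
  · rwa [habs]
  · rwa [habs]

theorem LaaksoStep.tail_height_arm (b : Bool) (i : Fin 4) :
    (LaaksoStep.arm b i).tail.height = ((i : ℝ) + 1) / 6 := by
  fin_cases i <;> simp [tail, LaaksoNode.height, LaaksoInner.onArm] <;> norm_num

theorem exists_sign (b : Bool) (θ : ℝ) :
    (bif b then θ else -θ) = (bif b then 1 else -1) * θ ∧
      ((bif b then 1 else -1 : ℝ) = 1 ∨ (bif b then 1 else -1 : ℝ) = -1) := by
  cases b <;> simp

theorem NearSegment.step {θ h : ℝ} {p : Heisenberg} (hθ : 0 < θ) (hθ1 : θ ≤ 1 / 1000)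
    (hp : NearSegment θ h p) (s : LaaksoStep) :
    NearSegment θ (s.tail.height + h / 6) (s.tail.pos θ * sim (s.vec θ) p) := by
  rcases s with _ | _ | ⟨b, i⟩
  · have e : (LaaksoStep.first.tail.pos θ * sim (LaaksoStep.first.vec θ) p) =
        ⟨p.x / 6, p.y / 6, p.z / 36⟩ := by
      ext <;> simp [LaaksoStep.tail, LaaksoStep.vec, LaaksoNode.pos, sim,
        Complex.normSq_apply] <;> ring
    have ea : area ⟨p.x / 6, p.y / 6, p.z / 36⟩ = area p / 36 := by simp only [area]; ring
    obtain ⟨h0, h1, x1, x2, y1, y2, a1, a2⟩ := hp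
    have k1 : 0 ≤ θ * h := by positivity
    have k2 : 0 ≤ θ * (1 - h) := mul_nonneg hθ.le (by linarith)
    have k3 : 0 ≤ θ * (h * (1 - h)) := mul_nonneg hθ.le (mul_nonneg h0 (by linarith))
    have k4 : 0 ≤ θ * (1 - h) ^ 2 := by positivity
    have k5 : 0 ≤ θ * h ^ 2 := by positivity
    rw [e, show LaaksoStep.first.tail.height + h / 6 = h / 6 by
      simp [LaaksoStep.tail, LaaksoNode.height]]
    rw [abs_le] at x1 x2 y1 y2 a1 a2
    constructor <;> (try rw [ea]) <;> (try rw [abs_le]) <;> (try constructor) <;>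
      (try dsimp only) <;> linarith
  · have e : (LaaksoStep.last.tail.pos θ * sim (LaaksoStep.last.vec θ) p) =
        ⟨(5 + p.x) / 6, p.y / 6, p.z / 36 + 5 * p.y / 72⟩ := by
      ext <;> simp [LaaksoStep.tail, LaaksoStep.vec, LaaksoNode.pos, sim,
        Complex.normSq_apply] <;> ring
    have ea : area ⟨(5 + p.x) / 6, p.y / 6, p.z / 36 + 5 * p.y / 72⟩ = area p / 36 := by
      simp only [area]; ring
    obtain ⟨h0, h1, x1, x2, y1, y2, a1, a2⟩ := hp
    have k1 : 0 ≤ θ * h := by positivity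
    have k2 : 0 ≤ θ * (1 - h) := mul_nonneg hθ.le (by linarith)
    have k3 : 0 ≤ θ * (h * (1 - h)) := mul_nonneg hθ.le (mul_nonneg h0 (by linarith))
    have k4 : 0 ≤ θ * (1 - h) ^ 2 := by positivity
    have k5 : 0 ≤ θ * h ^ 2 := by positivity
    rw [e, show LaaksoStep.last.tail.height + h / 6 = (5 + h) / 6 by
      simp [LaaksoStep.tail, LaaksoNode.height]; ring]
    rw [abs_le] at x1 x2 y1 y2 a1 a2
    constructor <;> (try rw [ea]) <;> (try rw [abs_le]) <;> (try constructor) <;>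
      (try dsimp only) <;> linarith
  · obtain ⟨hb, hε⟩ := exists_sign b θ
    have := (hp.arm hθ hθ1 hb hε i).nearSegment hθ hε
    rwa [LaaksoStep.tail_height_arm, ← add_div]

/-! ### Separation of points in different copies. -/

theorem NearArm.exists_fork {ε θ h : ℝ} {p : Heisenberg} (hp : NearArm ε θ h p) :
    ∃ μ, 0 ≤ μ ∧ (μ = h - 1 / 6 ∨ μ = 5 / 6 - h) ∧ |p.x - h| ≤ 7 * θ * μ ∧ |p.y| ≤ 7 * θ * μ ∧
      1 / 10 * θ * μ ^ 2 ≤ ε * area p := by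
  rcases le_total h (1 / 2) with h | h
  · exact ⟨_, by linarith [hp.ge], Or.inl rfl, hp.x_left, hp.y_left, hp.area_ge h⟩
  · exact ⟨_, by linarith [hp.le], Or.inr rfl, hp.x_right, hp.y_right, hp.area_ge' h⟩

/-- Points on opposite arms are separated in proportion to their distance within the cycle. -/
theorem NearArm.le_dist {ε θ h h' : ℝ} {p q : Heisenberg} (hθ : 0 < θ) (hθ1 : θ ≤ 1 / 1000)
    (hε : ε = 1 ∨ ε = -1) (hp : NearArm ε θ h p) (hq : NearArm (-ε) θ h' q) :
    Real.sqrt θ * min ((h - 1 / 6) + (h' - 1 / 6)) ((5 / 6 - h) + (5 / 6 - h')) ≤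
      16 * dist p q := by
  wlog h1 : ε = 1 generalizing ε h h' p q
  · have h2 : ε = -1 := hε.resolve_left h1
    subst h2
    have := this (ε := 1) (Or.inl rfl) (by simpa using hq) hp rfl
    rwa [dist_comm, add_comm (h' - 1 / 6), add_comm (5 / 6 - h')] at this
  subst h1
  obtain ⟨μ, hμ, hμh, hx, hy, hS⟩ := hp.exists_fork
  obtain ⟨ν, hν, hνh, hx', hy', hS'⟩ := hq.exists_fork
  have hφ : 0 < Real.sqrt θ := Real.sqrt_pos.2 hθ
  have hφθ : θ = Real.sqrt θ ^ 2 := (Real.sq_sqrt hθ.le).symm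
  have hφ1 : Real.sqrt θ ≤ 1 / 30 := by
    rw [Real.sqrt_le_left (by norm_num)]; linarith
  generalize Real.sqrt θ = φ at *
  have hN : 0 ≤ dist p q := dist_nonneg
  have hxN := abs_x_sub_le_dist p q
  have hA := area_sub_area_le p q
  generalize dist p q = N at *
  set r := max μ ν with hr
  have hμr : μ ≤ r := le_max_left _ _
  have hνr : ν ≤ r := le_max_right _ _
  have hr0 : 0 ≤ r := hμ.trans hμr
  have hr2 : r ^ 2 ≤ μ ^ 2 + ν ^ 2 := by
    rcases max_choice μ ν with h | h <;> rw [hr, h] <;> nlinarith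
  have hyy : |p.y + q.y| ≤ 14 * θ * r := by
    have := abs_add_le p.y q.y
    nlinarith
  -- The areas have opposite signs, so their difference is the sum of their sizes.
  have key : 1 / 10 * θ * r ^ 2 ≤ N ^ 2 + N * (7 * θ * r) := by
    have : N * |p.y + q.y| ≤ N * (14 * θ * r) := by gcongr
    nlinarith
  -- Otherwise the right side of `key` is at most `(1/25 + 7/150) * θ * r ^ 2`, which is below `1/10
  -- * θ * r ^ 2`.
  have hNr : φ * r ≤ 5 * N := by
    by_contra! hlt
    have k1 : N ^ 2 ≤ (φ * r / 5) ^ 2 := by gcongr; linarith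
    have k2 : N * (7 * θ * r) ≤ (φ * r / 5) * (7 * θ * r) := by gcongr; linarith
    have k3 : φ * (θ * r ^ 2) ≤ 1 / 30 * (θ * r ^ 2) := by gcongr
    have k4 : (φ * r / 5) ^ 2 = θ * r ^ 2 / 25 := by rw [hφθ]; ring
    have hrpos : 0 < r := by
      rcases hr0.eq_or_lt with h | h
      · rw [← h] at hlt; linarith
      · exact h
    have k5 : 0 < θ * r ^ 2 := by positivity
    nlinarith
  have hθr : θ * r ≤ 1 / 1000 * r := by gcongr
  have hθμ : θ * μ ≤ θ * r := by gcongr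
  have hθν : θ * ν ≤ θ * r := by gcongr
  -- The two points may be nearer to different forks; comparing `x`-coordinates still bounds the way
  -- round through the fork of `p`.
  have hD : min ((h - 1 / 6) + (h' - 1 / 6)) ((5 / 6 - h) + (5 / 6 - h')) ≤ 3 * r + N := by
    rw [abs_le] at hx hx' hxN
    rcases hμh with h1 | h1
    · exact (min_le_left _ _).trans (by linarith)
    · exact (min_le_right _ _).trans (by linarith)
  have hφN : φ * N ≤ 1 / 30 * N := by gcongr
  calc _ ≤ φ * (3 * r + N) := by gcongr
    _ ≤ 16 * N := by linarith

/-- Points on consecutive parts of `G₁` are separated by their `x`-coordinates. -/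
theorem NearSegment.le_dist {θ h h' : ℝ} {p q : Heisenberg} (hθ : 0 < θ) (hθ1 : θ ≤ 1 / 1000)
    (hp : NearSegment θ h p) (hq : NearSegment θ h' q) {s s' : LaaksoStep}
    (hs : s.head.height ≤ s'.tail.height) :
    (s'.tail.height + h' / 6) - (s.tail.height + h / 6) ≤
      2 * dist (s.tail.pos θ * sim (s.vec θ) p) (s'.tail.pos θ * sim (s'.vec θ) q) := by
  have hx := (le_abs_self _).trans
    (abs_x_sub_le_dist (s.tail.pos θ * sim (s.vec θ) p) (s'.tail.pos θ * sim (s'.vec θ) q))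
  simp only [mul_x, LaaksoStep.pos_tail_x, sim, LaaksoStep.re_vec] at hx ⊢
  rw [LaaksoStep.height_head] at hs
  have hh := hp.le_one
  have hh' := hq.nonneg
  -- The deviations vanish at the ends of an edge, so the error is relative to the height difference
  -- even for points close to a common vertex.
  have key : ∀ (t : LaaksoStep) (y u : ℝ), 0 ≤ u → |y| ≤ 5 * θ * u →
      |(t.vec θ).im * y| ≤ u / 100 := by
    intro t y u hu hy
    rw [abs_mul]
    have h1 := LaaksoStep.abs_im_vec_le hθ.le t
    calc _ ≤ θ / 6 * (5 * θ * u) := by gcongr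
      _ ≤ 1 / 1000 / 6 * (5 * (1 / 1000) * u) := by gcongr
      _ ≤ _ := by linarith
  have k1 := abs_le.1 (key s _ _ (by linarith) hp.y_right)
  have k2 := abs_le.1 (key s' _ _ hh' hq.y_left)
  have k3 := abs_le.1 hp.x_right
  have k4 := abs_le.1 hq.x_left
  have k5 : θ * (1 - h) ≤ 1 / 1000 * (1 - h) := by gcongr
  have k6 : θ * h' ≤ 1 / 1000 * h' := by gcongr
  linarith

theorem SimpleGraph.Connected.dist_le_mul_dist {V Y : Type*} [PseudoMetricSpace Y]
    {G : SimpleGraph V} (hG : G.Connected) {f : V → Y} {K : ℝ}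
    (hf : ∀ u v, G.Adj u v → Dist.dist (f u) (f v) ≤ K) (u v : V) :
    Dist.dist (f u) (f v) ≤ K * G.dist u v := by
  obtain ⟨w, hw⟩ := hG.exists_walk_length_eq_dist u v
  rw [← hw]
  clear hw
  induction w with
  | nil => simp
  | cons h w ih =>
    refine (dist_triangle _ (f _) _).trans ((add_le_add (hf _ _ h) ih).trans ?_)
    rw [SimpleGraph.Walk.length_cons]
    push_cast
    linarith

/-! ### The embedding -/

/-- The starting vertex of an edge of `Gₙ`. -/
def laaksoTail (n : ℕ) (e : (laaksoGraph n).E) : LaaksoVertex n := (laaksoGraph n).tail e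

/-- The end vertex of an edge of `Gₙ`. -/
def laaksoHead (n : ℕ) (e : (laaksoGraph n).E) : LaaksoVertex n := (laaksoGraph n).head e

/-- The vertices of the copy of `G₁` that replaces an edge of `Gₙ`. -/
def laaksoPlace (n : ℕ) (e : (laaksoGraph n).E) (w : LaaksoNode) : LaaksoVertex (n + 1) :=
  (laaksoGraph n).place e w

theorem laaksoSimpleGraph_adj {n : ℕ} {u v : LaaksoVertex n} :
    (laaksoSimpleGraph n).Adj u v ↔
      u ≠ v ∧ ((∃ e, laaksoTail n e = u ∧ laaksoHead n e = v) ∨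
        ∃ e, laaksoTail n e = v ∧ laaksoHead n e = u) :=
  SimpleGraph.fromRel_adj _ u v

theorem exists_edge_of_adj {n : ℕ} {u v : LaaksoVertex n} (h : (laaksoSimpleGraph n).Adj u v) :
    ∃ e, (laaksoTail n e = u ∧ laaksoHead n e = v) ∨
      (laaksoTail n e = v ∧ laaksoHead n e = u) := by
  obtain ⟨-, ⟨e, h⟩ | ⟨e, h⟩⟩ := laaksoSimpleGraph_adj.1 h
  · exact ⟨e, Or.inl h⟩
  · exact ⟨e, Or.inr h⟩

/-- The planar vector of an edge of `Gₙ`. -/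
noncomputable def laaksoVec (θ : ℝ) : (n : ℕ) → (laaksoGraph n).E → ℂ
  | 0, _ => 1
  | n + 1, (e, s) => laaksoVec θ n e * s.vec θ

/-- The embedding of `Gₙ` with slope `θ`. -/
noncomputable def laaksoPos (θ : ℝ) : (n : ℕ) → LaaksoVertex n → Heisenberg
  | 0, false => 1
  | 0, true => unitX
  | n + 1, Sum.inl v => laaksoPos θ n v
  | n + 1, Sum.inr (e, w) =>
    laaksoPos θ n (laaksoTail n e) * sim (laaksoVec θ n e) (LaaksoNode.pos θ (.inner w))

/-- The distance to the source in `Gₙ`, divided by `6 ^ n`. -/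
noncomputable def laaksoHeight : (n : ℕ) → LaaksoVertex n → ℝ
  | 0, false => 0
  | 0, true => 1
  | n + 1, Sum.inl v => laaksoHeight n v
  | n + 1, Sum.inr (e, w) =>
    laaksoHeight n (laaksoTail n e) + LaaksoNode.height (.inner w) / 6 ^ n

/-- The two statements feed each other: the formula for the sink of a copy is the head formula at
level `n`, and placement together with `pos_head` gives the head formula at level `n + 1`. -/
theorem laaksoPos_place_and_head (θ : ℝ) (n : ℕ) (e : (laaksoGraph n).E) :
    laaksoPos θ n (laaksoHead n e) =
      laaksoPos θ n (laaksoTail n e) * sim (laaksoVec θ n e) unitX ∧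
    ∀ w, laaksoPos θ (n + 1) (laaksoPlace n e w) =
      laaksoPos θ n (laaksoTail n e) * sim (laaksoVec θ n e) (w.pos θ) := by
  have place : ∀ (n : ℕ) (e : (laaksoGraph n).E), laaksoPos θ n (laaksoHead n e) =
      laaksoPos θ n (laaksoTail n e) * sim (laaksoVec θ n e) unitX →
      ∀ w, laaksoPos θ (n + 1) (laaksoPlace n e w) =
      laaksoPos θ n (laaksoTail n e) * sim (laaksoVec θ n e) (w.pos θ) := by
    intro n e h w
    match w with
    | .source =>
      rw [LaaksoNode.pos, sim_one, mul_one]; rfl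
    | .sink => exact h
    | .inner w => rfl
  suffices h : laaksoPos θ n (laaksoHead n e) =
      laaksoPos θ n (laaksoTail n e) * sim (laaksoVec θ n e) unitX from
    ⟨h, place n e h⟩
  induction n with
  | zero =>
    change unitX = 1 * sim 1 unitX
    rw [one_mul, one_sim]
  | succ n ih =>
    obtain ⟨e, s⟩ := e
    have h := place n e (ih e)
    change laaksoPos θ (n + 1) (laaksoPlace n e s.head) =
      laaksoPos θ (n + 1) (laaksoPlace n e s.tail) *
        sim (laaksoVec θ n e * s.vec θ) unitX
    rw [h, h, s.pos_head, sim_mul, sim_sim, mul_assoc]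

theorem dist_laaksoPos_edge (θ : ℝ) (n : ℕ) (e : (laaksoGraph n).E) :
    dist (laaksoPos θ n (laaksoTail n e)) (laaksoPos θ n (laaksoHead n e)) =
      ‖laaksoVec θ n e‖ := by
  rw [(laaksoPos_place_and_head θ n e).1, dist_def, inv_mul_cancel_left, koranyi_sim,
    koranyi_unitX, mul_one]

theorem norm_laaksoVec_le {θ : ℝ} (hθ : 0 ≤ θ) (n : ℕ) (e : (laaksoGraph n).E) :
    ‖laaksoVec θ n e‖ ≤ (Real.sqrt (1 + θ ^ 2) / 6) ^ n := by
  induction n with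
  | zero => change ‖(1 : ℂ)‖ ≤ _; simp
  | succ n ih =>
    obtain ⟨e, s⟩ := e
    change ‖laaksoVec θ n e * s.vec θ‖ ≤ _
    rw [norm_mul, pow_succ]
    exact mul_le_mul (ih e) (LaaksoStep.norm_vec_le hθ s) (norm_nonneg _) (by positivity)

theorem LaaksoVertex.dist_eq {n : ℕ} (u v : LaaksoVertex n) :
    dist u v = ((laaksoSimpleGraph n).dist u v : ℝ) := rfl

theorem dist_laaksoPos_le {θ : ℝ} (hθ : 0 ≤ θ) (n : ℕ) (u v : LaaksoVertex n) :
    dist (laaksoPos θ n u) (laaksoPos θ n v) ≤ (Real.sqrt (1 + θ ^ 2) / 6) ^ n * dist u v := by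
  refine (laaksoSimpleGraph_connected n).dist_le_mul_dist ?_ u v
  intro u v h
  obtain ⟨e, ⟨rfl, rfl⟩ | ⟨rfl, rfl⟩⟩ := exists_edge_of_adj h
  · rw [dist_laaksoPos_edge]; exact norm_laaksoVec_le hθ n e
  · rw [dist_comm, dist_laaksoPos_edge]; exact norm_laaksoVec_le hθ n e

/-! ### The ten copies of `Gₙ` in `Gₙ₊₁` -/

/-- The edge of `Gₙ₊₁` that corresponds to an edge of `Gₙ` in the copy at the edge `s` of `G₁`. -/
def copyEdge (s : LaaksoStep) : (n : ℕ) → (laaksoGraph n).E → (laaksoGraph (n + 1)).E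
  | 0, _ => ((), s)
  | n + 1, (e, t) => (copyEdge s n e, t)

/-- A vertex of `G₁` as a vertex of `Gₙ₊₁`. -/
def laaksoNode : (n : ℕ) → LaaksoNode → LaaksoVertex (n + 1)
  | 0, w => laaksoPlace 0 () w
  | n + 1, w => Sum.inl (laaksoNode n w)

/-- The vertex of `Gₙ₊₁` that corresponds to a vertex of `Gₙ` in the copy at the edge `s`
of `G₁`. -/
def copyVertex (s : LaaksoStep) : (n : ℕ) → LaaksoVertex n → LaaksoVertex (n + 1)
  | 0, false => laaksoNode 0 s.tail
  | 0, true => laaksoNode 0 s.head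
  | n + 1, Sum.inl v => Sum.inl (copyVertex s n v)
  | n + 1, Sum.inr (e, w) => Sum.inr (copyEdge s n e, w)

/-- The end points of `Gₙ`. -/
def laaksoEnd : (n : ℕ) → Bool → LaaksoVertex n
  | 0, b => b
  | n + 1, b => Sum.inl (laaksoEnd n b)

/-- The graphs are built by refining the finest edges, whereas the estimates induct on the coarsest
level. Compatibility of the copies with incidence links the two descriptions. -/
theorem copyVertex_tail_head (s : LaaksoStep) (n : ℕ) (e : (laaksoGraph n).E) :
    laaksoTail (n + 1) (copyEdge s n e) = copyVertex s n (laaksoTail n e) ∧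
    laaksoHead (n + 1) (copyEdge s n e) = copyVertex s n (laaksoHead n e) := by
  induction n with
  | zero => exact ⟨rfl, rfl⟩
  | succ n ih =>
    obtain ⟨e, t⟩ := e
    have place : ∀ w, laaksoPlace (n + 1) (copyEdge s n e) w =
        copyVertex s (n + 1) (laaksoPlace n e w) := by
      intro w
      match w with
      | .source => exact congrArg Sum.inl (ih e).1
      | .sink => exact congrArg Sum.inl (ih e).2
      | .inner w => rfl
    exact ⟨place t.tail, place t.head⟩

theorem copyVertex_end (s : LaaksoStep) (n : ℕ) :
    copyVertex s n (laaksoEnd n false) = laaksoNode n s.tail ∧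
    copyVertex s n (laaksoEnd n true) = laaksoNode n s.head := by
  induction n with
  | zero => exact ⟨rfl, rfl⟩
  | succ n ih => exact ⟨congrArg Sum.inl ih.1, congrArg Sum.inl ih.2⟩

theorem laaksoNode_source_sink (n : ℕ) :
    laaksoNode n .source = laaksoEnd (n + 1) false ∧
    laaksoNode n .sink = laaksoEnd (n + 1) true := by
  induction n with
  | zero => exact ⟨rfl, rfl⟩
  | succ n ih => exact ⟨congrArg Sum.inl ih.1, congrArg Sum.inl ih.2⟩

theorem exists_copyEdge (n : ℕ) (e : (laaksoGraph (n + 1)).E) : ∃ s e', copyEdge s n e' = e := by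
  induction n with
  | zero => obtain ⟨⟨⟩, s⟩ := e; exact ⟨s, (), rfl⟩
  | succ n ih =>
    obtain ⟨e, t⟩ := e
    obtain ⟨s, e', rfl⟩ := ih e
    exact ⟨s, (e', t), rfl⟩

/-- A vertex shared by several copies has several representations; the later estimates hold for each
of them. -/
theorem exists_copyVertex (n : ℕ) (v : LaaksoVertex (n + 1)) : ∃ s v', copyVertex s n v' = v := by
  induction n with
  | zero =>
    match v with
    | Sum.inl false => exact ⟨.first, false, rfl⟩
    | Sum.inl true => exact ⟨.last, true, rfl⟩
    | Sum.inr ((), .forkLeft) => exact ⟨.first, true, rfl⟩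
    | Sum.inr ((), .forkRight) => exact ⟨.last, false, rfl⟩
    | Sum.inr ((), .arm b i) =>
      refine ⟨.arm b i.castSucc, true, ?_⟩
      fin_cases i <;> rfl
  | succ n ih =>
    match v with
    | Sum.inl v =>
      obtain ⟨s, v', rfl⟩ := ih v
      exact ⟨s, Sum.inl v', rfl⟩
    | Sum.inr (e, w) =>
      obtain ⟨s, e', rfl⟩ := exists_copyEdge n e
      exact ⟨s, Sum.inr (e', w), rfl⟩

theorem laaksoVec_copyEdge (θ : ℝ) (s : LaaksoStep) (n : ℕ) (e : (laaksoGraph n).E) :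
    laaksoVec θ (n + 1) (copyEdge s n e) = s.vec θ * laaksoVec θ n e := by
  induction n with
  | zero => change 1 * s.vec θ = s.vec θ * 1; rw [mul_comm]
  | succ n ih =>
    obtain ⟨e, t⟩ := e
    change laaksoVec θ (n + 1) (copyEdge s n e) * t.vec θ = s.vec θ * (laaksoVec θ n e * t.vec θ)
    rw [ih, mul_assoc]

/-- Self-similarity: each of the ten copies is embedded by a similarity followed by a left
translation. This is what the metric inductions use. -/
theorem laaksoPos_copyVertex (θ : ℝ) (s : LaaksoStep) (n : ℕ) (v : LaaksoVertex n) :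
    laaksoPos θ (n + 1) (copyVertex s n v) =
      s.tail.pos θ * sim (s.vec θ) (laaksoPos θ n v) := by
  induction n with
  | zero =>
    have h : ∀ w, laaksoPos θ 1 (laaksoNode 0 w) = w.pos θ := by
      intro w
      refine ((laaksoPos_place_and_head θ 0 ()).2 w).trans ?_
      change 1 * sim 1 _ = _
      rw [one_mul, one_sim]
    match v with
    | false =>
      refine (h s.tail).trans ?_
      change _ = _ * sim _ 1
      rw [sim_one, mul_one]
    | true => exact (h s.head).trans (s.pos_head θ)
  | succ n ih =>
    match v with
    | Sum.inl v => exact ih v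
    | Sum.inr (e, w) =>
      change laaksoPos θ (n + 1) (laaksoTail (n + 1) (copyEdge s n e)) *
        sim (laaksoVec θ (n + 1) (copyEdge s n e)) (LaaksoNode.pos θ (.inner w)) =
        _ * sim _ (laaksoPos θ n (laaksoTail n e) *
          sim (laaksoVec θ n e) (LaaksoNode.pos θ (.inner w)))
      rw [(copyVertex_tail_head s n e).1, ih, laaksoVec_copyEdge, sim_mul, sim_sim, mul_assoc]

theorem laaksoHeight_copyVertex (s : LaaksoStep) (n : ℕ) (v : LaaksoVertex n) :
    laaksoHeight (n + 1) (copyVertex s n v) = s.tail.height + laaksoHeight n v / 6 := by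
  induction n with
  | zero =>
    have h : ∀ w, laaksoHeight 1 (laaksoNode 0 w) = w.height := by
      intro w
      match w with
      | .source => rfl
      | .sink => rfl
      | .inner w =>
        change 0 + LaaksoNode.height (.inner w) / 6 ^ 0 = _
        simp
    match v with
    | false =>
      refine (h s.tail).trans ?_
      change _ = _ + 0 / 6
      simp
    | true => exact (h s.head).trans s.height_head
  | succ n ih =>
    match v with
    | Sum.inl v => exact ih v
    | Sum.inr (e, w) =>
      change laaksoHeight (n + 1) (laaksoTail (n + 1) (copyEdge s n e)) +
        LaaksoNode.height (.inner w) / 6 ^ (n + 1) =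
        _ + (laaksoHeight n (laaksoTail n e) + LaaksoNode.height (.inner w) / 6 ^ n) / 6
      rw [(copyVertex_tail_head s n e).1, ih, pow_succ]
      field_simp
      ring

theorem nearSegment_laaksoPos {θ : ℝ} (hθ : 0 < θ) (hθ1 : θ ≤ 1 / 1000) (n : ℕ)
    (v : LaaksoVertex n) : NearSegment θ (laaksoHeight n v) (laaksoPos θ n v) := by
  induction n with
  | zero =>
    match v with
    | false => exact nearSegment_one hθ.le
    | true => exact nearSegment_unitX hθ.le
  | succ n ih =>
    obtain ⟨s, v, rfl⟩ := exists_copyVertex n v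
    rw [laaksoPos_copyVertex, laaksoHeight_copyVertex]
    exact (ih v).step hθ hθ1 s

/-! ### Upper bounds for distances in Laakso graphs -/

theorem dist_tail_head_le_one (n : ℕ) (e : (laaksoGraph n).E) :
    dist (laaksoTail n e) (laaksoHead n e) ≤ 1 := by
  rw [LaaksoVertex.dist_eq]
  by_cases h : laaksoTail n e = laaksoHead n e
  · rw [h]
    simp
  · have : (laaksoSimpleGraph n).Adj (laaksoTail n e) (laaksoHead n e) :=
      laaksoSimpleGraph_adj.2 ⟨h, Or.inl ⟨e, rfl, rfl⟩⟩
    rw [SimpleGraph.dist_eq_one_iff_adj.2 this]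
    simp

/-- Copies send edges to edges. Only upper bounds for graph distances are needed, because they turn
lower bounds in terms of heights into lower bounds for the embedding. -/
theorem dist_copyVertex_le (s : LaaksoStep) (n : ℕ) (u v : LaaksoVertex n) :
    dist (copyVertex s n u) (copyVertex s n v) ≤ dist u v := by
  rw [LaaksoVertex.dist_eq u v, ← one_mul ((laaksoSimpleGraph n).dist u v : ℝ)]
  refine (laaksoSimpleGraph_connected n).dist_le_mul_dist ?_ u v
  intro u v h
  have key : ∀ e, dist (copyVertex s n (laaksoTail n e))
      (copyVertex s n (laaksoHead n e)) ≤ 1 := by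
    intro e
    rw [← (copyVertex_tail_head s n e).1, ← (copyVertex_tail_head s n e).2]
    exact dist_tail_head_le_one _ _
  obtain ⟨e, ⟨rfl, rfl⟩ | ⟨rfl, rfl⟩⟩ := exists_edge_of_adj h
  · exact key e
  · rw [dist_comm]; exact key e

theorem height_onArm (b : Bool) (i : Fin 5) :
    LaaksoNode.height (.inner (.onArm b i)) = ((i : ℝ) + 1) / 6 := by
  fin_cases i <;> simp [LaaksoNode.height, LaaksoInner.onArm] <;> norm_num

/-- Two edges of `G₁` are equal, lie on a common directed path, or lie on opposite arms. -/
theorem LaaksoStep.trichotomy (s s' : LaaksoStep) : s = s' ∨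
    (∃ b i j, i ≤ j ∧ s.head = .inner (.onArm b i) ∧ s'.tail = .inner (.onArm b j)) ∨
    (∃ b i j, i ≤ j ∧ s'.head = .inner (.onArm b i) ∧ s.tail = .inner (.onArm b j)) ∨
    (∃ b i j, s = .arm b i ∧ s' = .arm (!b) j) := by
  rcases s with _ | _ | ⟨b, i⟩ <;> rcases s' with _ | _ | ⟨b', j⟩
  · exact Or.inl rfl
  · exact Or.inr (Or.inl ⟨true, 0, 4, Fin.zero_le _, rfl, rfl⟩)
  · exact Or.inr (Or.inl ⟨b', 0, j.castSucc, Fin.zero_le _, rfl, rfl⟩)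
  · exact Or.inr (Or.inr (Or.inl ⟨true, 0, 4, Fin.zero_le _, rfl, rfl⟩))
  · exact Or.inl rfl
  · exact Or.inr (Or.inr (Or.inl ⟨b', j.succ, 4, Fin.le_last _, rfl, rfl⟩))
  · exact Or.inr (Or.inr (Or.inl ⟨b, 0, i.castSucc, Fin.zero_le _, rfl, rfl⟩))
  · exact Or.inr (Or.inl ⟨b, i.succ, 4, Fin.le_last _, rfl, rfl⟩)
  · by_cases hb : b' = !b
    · exact Or.inr (Or.inr (Or.inr ⟨b, i, j, rfl, by rw [hb]⟩))
    · obtain rfl : b = b' := by revert hb; cases b <;> cases b' <;> simp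
      rcases lt_trichotomy i j with h | rfl | h
      · exact Or.inr (Or.inl ⟨b, i.succ, j.castSucc, Fin.succ_le_castSucc_iff.2 h, rfl, rfl⟩)
      · exact Or.inl rfl
      · exact Or.inr (Or.inr (Or.inl
          ⟨b, j.succ, i.castSucc, Fin.succ_le_castSucc_iff.2 h, rfl, rfl⟩))

theorem dist_onArm_le {n : ℕ}
    (h : dist (laaksoEnd n false) (laaksoEnd n true) ≤ 6 ^ n) (b : Bool) (i j : Fin 5)
    (hij : i ≤ j) :
    dist (laaksoNode n (.inner (.onArm b i))) (laaksoNode n (.inner (.onArm b j))) ≤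
      6 ^ (n + 1) * (LaaksoNode.height (.inner (.onArm b j)) -
        LaaksoNode.height (.inner (.onArm b i))) := by
  induction j using Fin.induction with
  | zero =>
    obtain rfl : i = 0 := Fin.le_zero_iff.1 hij
    simp
  | succ j ih =>
    rcases hij.eq_or_lt with rfl | hlt
    · simp
    · have h1 := ih (Fin.le_castSucc_iff.2 hlt)
      have h2 := (dist_copyVertex_le (.arm b j) n _ _).trans h
      rw [(copyVertex_end _ n).1, (copyVertex_end _ n).2] at h2
      have h3 := (LaaksoStep.arm b j).height_head
      change dist (laaksoNode n (.inner (.onArm b j.castSucc)))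
        (laaksoNode n (.inner (.onArm b j.succ))) ≤ _ at h2
      change LaaksoNode.height (.inner (.onArm b j.succ)) =
        LaaksoNode.height (.inner (.onArm b j.castSucc)) + 1 / 6 at h3
      refine (dist_triangle _ _ _).trans ((add_le_add h1 h2).trans ?_)
      rw [h3, pow_succ]
      apply le_of_eq
      ring

theorem dist_end_le (n : ℕ) (v : LaaksoVertex n) :
    dist (laaksoEnd n false) v ≤ 6 ^ n * laaksoHeight n v ∧
      dist v (laaksoEnd n true) ≤ 6 ^ n * (1 - laaksoHeight n v) := by
  induction n with
  | zero =>
    have h : dist (laaksoEnd 0 false) (laaksoEnd 0 true) ≤ 1 := dist_tail_head_le_one 0 ()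
    match v with
    | false =>
      refine ⟨?_, ?_⟩
      · change dist (laaksoEnd 0 false) (laaksoEnd 0 false) ≤ 6 ^ 0 * 0
        simp
      · refine h.trans ?_
        change (1 : ℝ) ≤ 6 ^ 0 * (1 - 0)
        norm_num
    | true =>
      refine ⟨?_, ?_⟩
      · refine h.trans ?_
        change (1 : ℝ) ≤ 6 ^ 0 * 1
        norm_num
      · change dist (laaksoEnd 0 true) (laaksoEnd 0 true) ≤ 6 ^ 0 * (1 - 1)
        simp
  | succ n ih =>
    -- The second bound at the sink itself forces its height to be at most 1, so that height need
    -- not be computed.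
    have hends : dist (laaksoEnd n false) (laaksoEnd n true) ≤ 6 ^ n := by
      have h1 := (ih (laaksoEnd n true)).1
      have h2 := (ih (laaksoEnd n true)).2
      rw [dist_self] at h2
      linarith
    have hstep : ∀ s : LaaksoStep,
        dist (laaksoNode n s.tail) (laaksoNode n s.head) ≤ 6 ^ n := by
      intro s
      rw [← (copyVertex_end s n).1, ← (copyVertex_end s n).2]
      exact (dist_copyVertex_le s n _ _).trans hends
    have hfirst : dist (laaksoEnd (n + 1) false) (laaksoNode n (.inner .forkLeft)) ≤ 6 ^ n := by
      rw [← (laaksoNode_source_sink n).1]; exact hstep .first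
    have hlast : dist (laaksoNode n (.inner .forkRight)) (laaksoEnd (n + 1) true) ≤ 6 ^ n := by
      rw [← (laaksoNode_source_sink n).2]; exact hstep .last
    have hleft : ∀ b i, dist (laaksoEnd (n + 1) false) (laaksoNode n (.inner (.onArm b i))) ≤
        6 ^ (n + 1) * LaaksoNode.height (.inner (.onArm b i)) := by
      intro b i
      have h1 := dist_onArm_le hends b 0 i (Fin.zero_le _)
      refine (dist_triangle _ _ _).trans ((add_le_add hfirst h1).trans ?_)
      rw [height_onArm b 0, pow_succ]
      apply le_of_eq
      simp only [Fin.val_zero, Nat.cast_zero]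
      ring
    have hright : ∀ b i, dist (laaksoNode n (.inner (.onArm b i))) (laaksoEnd (n + 1) true) ≤
        6 ^ (n + 1) * (1 - LaaksoNode.height (.inner (.onArm b i))) := by
      intro b i
      have h1 := dist_onArm_le hends b i 4 (Fin.le_last _)
      refine (dist_triangle _ _ _).trans ((add_le_add h1 hlast).trans ?_)
      rw [height_onArm b 4, pow_succ]
      apply le_of_eq
      norm_num
      ring
    obtain ⟨s, v, rfl⟩ := exists_copyVertex n v
    have hL : dist (laaksoEnd (n + 1) false) (laaksoNode n s.tail) ≤
        6 ^ (n + 1) * s.tail.height := by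
      rcases s with _ | _ | ⟨b, i⟩
      · change dist (laaksoEnd (n + 1) false) (laaksoNode n .source) ≤ 6 ^ (n + 1) * 0
        rw [(laaksoNode_source_sink n).1]; simp
      · exact hleft true 4
      · exact hleft b i.castSucc
    have hR : dist (laaksoNode n s.head) (laaksoEnd (n + 1) true) ≤
        6 ^ (n + 1) * (1 - s.head.height) := by
      rcases s with _ | _ | ⟨b, i⟩
      · exact hright true 0
      · change dist (laaksoNode n .sink) (laaksoEnd (n + 1) true) ≤ 6 ^ (n + 1) * (1 - 1)
        rw [(laaksoNode_source_sink n).2]; simp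
      · exact hright b i.succ
    have h1 := (dist_copyVertex_le s n _ _).trans (ih v).1
    have h2 := (dist_copyVertex_le s n _ _).trans (ih v).2
    rw [(copyVertex_end s n).1] at h1
    rw [(copyVertex_end s n).2] at h2
    rw [laaksoHeight_copyVertex]
    constructor
    · refine (dist_triangle _ _ _).trans ((add_le_add hL h1).trans ?_)
      apply le_of_eq
      rw [pow_succ]; ring
    · refine (dist_triangle _ _ _).trans ((add_le_add h2 hR).trans ?_)
      apply le_of_eq
      rw [s.height_head, pow_succ]; ring

theorem dist_ends_le (n : ℕ) : dist (laaksoEnd n false) (laaksoEnd n true) ≤ 6 ^ n := by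
  have h1 := (dist_end_le n (laaksoEnd n true)).1
  have h2 := (dist_end_le n (laaksoEnd n true)).2
  rw [dist_self] at h2
  linarith

theorem dist_node_tail_le (s : LaaksoStep) (n : ℕ) (v : LaaksoVertex n) :
    dist (laaksoNode n s.tail) (copyVertex s n v) ≤ 6 ^ n * laaksoHeight n v := by
  rw [← (copyVertex_end s n).1]
  exact (dist_copyVertex_le s n _ _).trans (dist_end_le n v).1

theorem dist_node_head_le (s : LaaksoStep) (n : ℕ) (v : LaaksoVertex n) :
    dist (copyVertex s n v) (laaksoNode n s.head) ≤ 6 ^ n * (1 - laaksoHeight n v) := by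
  rw [← (copyVertex_end s n).2]
  exact (dist_copyVertex_le s n _ _).trans (dist_end_le n v).2

/-- Vertices on a common directed path are at most as far apart as their heights indicate. -/
theorem dist_le_height_sub {s s' : LaaksoStep} {b : Bool} {i j : Fin 5} (hij : i ≤ j)
    (hs : s.head = .inner (.onArm b i)) (hs' : s'.tail = .inner (.onArm b j)) (n : ℕ)
    (u v : LaaksoVertex n) :
    dist (copyVertex s n u) (copyVertex s' n v) ≤ 6 ^ (n + 1) *
      (laaksoHeight (n + 1) (copyVertex s' n v) - laaksoHeight (n + 1) (copyVertex s n u)) := by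
  have h1 := dist_node_head_le s n u
  have h2 := dist_onArm_le (dist_ends_le n) b i j hij
  have h3 := dist_node_tail_le s' n v
  have h4 := s.height_head
  rw [laaksoHeight_copyVertex, laaksoHeight_copyVertex]
  rw [← hs, ← hs'] at h2
  refine (dist_triangle4 _ _ _ _).trans ((add_le_add (add_le_add h1 h2) h3).trans ?_)
  apply le_of_eq
  rw [h4, pow_succ]
  ring

theorem dist_fork_le (b : Bool) (i : Fin 4) (n : ℕ) (v : LaaksoVertex n) :
    dist (laaksoNode n (.inner .forkLeft)) (copyVertex (.arm b i) n v) ≤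
        6 ^ (n + 1) * (laaksoHeight (n + 1) (copyVertex (.arm b i) n v) - 1 / 6) ∧
      dist (copyVertex (.arm b i) n v) (laaksoNode n (.inner .forkRight)) ≤
        6 ^ (n + 1) * (5 / 6 - laaksoHeight (n + 1) (copyVertex (.arm b i) n v)) := by
  rw [laaksoHeight_copyVertex]
  have e := (LaaksoStep.arm b i).height_head
  constructor
  · have h1 := dist_onArm_le (dist_ends_le n) b 0 i.castSucc (Fin.zero_le _)
    have h2 := dist_node_tail_le (.arm b i) n v
    refine (dist_triangle _ _ _).trans ((add_le_add h1 h2).trans ?_)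
    apply le_of_eq
    rw [height_onArm b 0, pow_succ]
    change _ * (LaaksoNode.height (LaaksoStep.arm b i).tail - _) + _ = _
    simp only [Fin.val_zero, Nat.cast_zero]
    ring
  · have h1 := dist_onArm_le (dist_ends_le n) b i.succ 4 (Fin.le_last _)
    have h2 := dist_node_head_le (.arm b i) n v
    refine (dist_triangle _ _ _).trans ((add_le_add h2 h1).trans ?_)
    apply le_of_eq
    rw [height_onArm b 4, pow_succ]
    change _ + _ * (_ - LaaksoNode.height (LaaksoStep.arm b i).head) = _
    rw [e]
    norm_num
    ring

theorem dist_opposite_le (b : Bool) (i j : Fin 4) (n : ℕ) (u v : LaaksoVertex n) :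
    dist (copyVertex (.arm b i) n u) (copyVertex (.arm (!b) j) n v) ≤ 6 ^ (n + 1) *
      min ((laaksoHeight (n + 1) (copyVertex (.arm b i) n u) - 1 / 6) +
          (laaksoHeight (n + 1) (copyVertex (.arm (!b) j) n v) - 1 / 6))
        ((5 / 6 - laaksoHeight (n + 1) (copyVertex (.arm b i) n u)) +
          (5 / 6 - laaksoHeight (n + 1) (copyVertex (.arm (!b) j) n v))) := by
  obtain ⟨h1, h2⟩ := dist_fork_le b i n u
  obtain ⟨h3, h4⟩ := dist_fork_le (!b) j n v
  rw [mul_min_of_nonneg _ _ (by positivity), mul_add, mul_add]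
  rw [dist_comm] at h1 h4
  exact le_min ((dist_triangle _ _ _).trans (add_le_add h1 h3))
    ((dist_triangle _ _ _).trans (add_le_add h2 h4))

/-! ### The lower bound -/

/-- The constant 16 does not deteriorate with `n`: inside one copy the similarity contracts by at
most 6, which the factor `6 ^ n` absorbs, and points in different copies are handled at once without
the induction hypothesis. -/
theorem dist_le_dist_laaksoPos {θ : ℝ} (hθ : 0 < θ) (hθ1 : θ ≤ 1 / 1000) (n : ℕ)
    (u v : LaaksoVertex n) :
    Real.sqrt θ * dist u v ≤ 16 * 6 ^ n * dist (laaksoPos θ n u) (laaksoPos θ n v) := by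
  have hφ : Real.sqrt θ ≤ 1 := by rw [Real.sqrt_le_one]; linarith
  have hφ0 := Real.sqrt_nonneg θ
  induction n with
  | zero =>
    have h : Real.sqrt θ * dist (laaksoEnd 0 false) (laaksoEnd 0 true) ≤ 1 :=
      mul_le_one₀ hφ dist_nonneg (dist_tail_head_le_one 0 ())
    have h' : dist (laaksoPos θ 0 (laaksoEnd 0 false)) (laaksoPos θ 0 (laaksoEnd 0 true)) = 1 := by
      change dist 1 unitX = 1
      rw [dist_def, inv_one, one_mul, koranyi_unitX]
    match u, v with
    | false, false =>
      change _ * dist (laaksoEnd 0 false) (laaksoEnd 0 false) ≤ _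
      rw [dist_self]; simp
    | true, true =>
      change _ * dist (laaksoEnd 0 true) (laaksoEnd 0 true) ≤ _
      rw [dist_self]; simp
    | false, true =>
      change _ * dist (laaksoEnd 0 false) (laaksoEnd 0 true) ≤
        _ * dist (laaksoPos θ 0 (laaksoEnd 0 false)) (laaksoPos θ 0 (laaksoEnd 0 true))
      rw [h']; linarith
    | true, false =>
      change _ * dist (laaksoEnd 0 true) (laaksoEnd 0 false) ≤
        _ * dist (laaksoPos θ 0 (laaksoEnd 0 true)) (laaksoPos θ 0 (laaksoEnd 0 false))
      rw [dist_comm, dist_comm (laaksoPos _ _ _), h']; linarith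
  | succ n ih =>
    obtain ⟨s, u, rfl⟩ := exists_copyVertex n u
    obtain ⟨s', v, rfl⟩ := exists_copyVertex n v
    have hnear := nearSegment_laaksoPos hθ hθ1 n
    have series : ∀ (s s' : LaaksoStep) (u v : LaaksoVertex n) (b : Bool) (i j : Fin 5), i ≤ j →
        s.head = .inner (.onArm b i) → s'.tail = .inner (.onArm b j) →
        Real.sqrt θ * dist (copyVertex s n u) (copyVertex s' n v) ≤ 16 * 6 ^ (n + 1) *
          dist (laaksoPos θ (n + 1) (copyVertex s n u))
            (laaksoPos θ (n + 1) (copyVertex s' n v)) := by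
      intro s s' u v b i j hij hs hs'
      have h1 := dist_le_height_sub hij hs hs' n u v
      have hle : s.head.height ≤ s'.tail.height := by
        rw [hs, hs', height_onArm, height_onArm]
        gcongr
        exact hij
      have h2 := (hnear u).le_dist hθ hθ1 (hnear v) hle
      rw [← laaksoHeight_copyVertex, ← laaksoHeight_copyVertex, ← laaksoPos_copyVertex,
        ← laaksoPos_copyVertex] at h2
      calc _ ≤ 1 * dist (copyVertex s n u) (copyVertex s' n v) := by gcongr
        _ ≤ 6 ^ (n + 1) * (2 * dist (laaksoPos θ (n + 1) (copyVertex s n u))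
            (laaksoPos θ (n + 1) (copyVertex s' n v))) := by
          rw [one_mul]; exact h1.trans (by gcongr)
        _ = 2 * 6 ^ (n + 1) * dist (laaksoPos θ (n + 1) (copyVertex s n u))
            (laaksoPos θ (n + 1) (copyVertex s' n v)) := by ring
        _ ≤ _ := by gcongr; norm_num
    rcases s.trichotomy s' with rfl | ⟨b, i, j, hij, hs, hs'⟩ | ⟨b, i, j, hij, hs, hs'⟩ |
      ⟨b, i, j, rfl, rfl⟩
    · have h1 := ih u v
      have h2 := dist_copyVertex_le s n u v
      have h3 := s.norm_vec_ge θ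
      rw [laaksoPos_copyVertex, laaksoPos_copyVertex, dist_mul_left', dist_sim]
      calc _ ≤ Real.sqrt θ * dist u v := by gcongr
        _ ≤ _ := h1
        _ = 16 * 6 ^ (n + 1) * (1 / 6 * dist (laaksoPos θ n u) (laaksoPos θ n v)) := by
          rw [pow_succ]; ring
        _ ≤ _ := by gcongr
    · exact series s s' u v b i j hij hs hs'
    · rw [dist_comm, dist_comm (laaksoPos _ _ _)]
      exact series s' s v u b i j hij hs hs'
    · obtain ⟨hb, hε⟩ := exists_sign b θ
      obtain ⟨hb', -⟩ := exists_sign (!b) θ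
      have hneg : (bif !b then 1 else -1 : ℝ) = -(bif b then 1 else -1) := by cases b <;> simp
      rw [hneg] at hb'
      have hε' : -(bif b then 1 else -1 : ℝ) = 1 ∨ -(bif b then 1 else -1 : ℝ) = -1 := by
        cases b <;> simp
      have A := (hnear u).arm hθ hθ1 hb hε i
      have B := (hnear v).arm hθ hθ1 hb' hε' j
      rw [add_div, ← LaaksoStep.tail_height_arm b, ← laaksoHeight_copyVertex,
        ← laaksoPos_copyVertex] at A
      rw [add_div, ← LaaksoStep.tail_height_arm (!b), ← laaksoHeight_copyVertex,
        ← laaksoPos_copyVertex] at B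
      have C := A.le_dist hθ hθ1 hε B
      have D := dist_opposite_le b i j n u v
      calc _ ≤ _ := mul_le_mul_of_nonneg_left D hφ0
        _ = 6 ^ (n + 1) * (Real.sqrt θ * _) := by ring
        _ ≤ 6 ^ (n + 1) * (16 * _) := mul_le_mul_of_nonneg_left C (by positivity)
        _ = _ := by ring

/-! ### Choice of the slope. -/

theorem EmbedsWithDistortion.mono {X Y : Type*} [MetricSpace X] [MetricSpace Y] {D D' : ℝ}
    (h : EmbedsWithDistortion X Y D) (hD : D ≤ D') : EmbedsWithDistortion X Y D' := by
  obtain ⟨h1, f, s, hs, hf⟩ := h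
  refine ⟨h1.trans hD, f, s, hs, fun u v => ⟨(hf u v).1, (hf u v).2.trans ?_⟩⟩
  gcongr

theorem embedsWithDistortion_laaksoVertex (n : ℕ) (hn : 1 ≤ n) :
    EmbedsWithDistortion (LaaksoVertex n) Heisenberg (1536 * (n : ℝ) ^ (1 / 4 : ℝ)) := by
  have hn' : (1 : ℝ) ≤ n := by exact_mod_cast hn
  have hq1 : 1 ≤ (n : ℝ) ^ (1 / 4 : ℝ) := Real.one_le_rpow hn' (by norm_num)
  have hq4 : ((n : ℝ) ^ (1 / 4 : ℝ)) ^ 4 = n := by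
    rw [← Real.rpow_natCast, ← Real.rpow_mul (by positivity)]
    norm_num
  generalize (n : ℝ) ^ (1 / 4 : ℝ) = q at *
  have hq0 : 0 < q := by linarith
  -- The slope is of order `n^(-1/2)`, the largest order for which `n * θ ^ 2`, and with it the
  -- stretch, stays bounded. The factor 32 gives `θ ≤ 1/1024`.
  set θ : ℝ := (1 / (32 * q)) ^ 2 with hθ_def
  have hθ : 0 < θ := by positivity
  have hsqrt : Real.sqrt θ = 1 / (32 * q) := Real.sqrt_sq (by positivity)
  have hθ1 : θ ≤ 1 / 1000 := by
    have : 1 / (32 * q) ≤ 1 / 32 := by gcongr; linarith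
    calc θ ≤ (1 / 32) ^ 2 := by rw [hθ_def]; gcongr
      _ ≤ _ := by norm_num
  have hθn : n * θ ^ 2 ≤ 1 := by
    rw [← hq4, hθ_def]
    field_simp
    norm_num
  have hpow : Real.sqrt (1 + θ ^ 2) ^ n ≤ 3 := by
    have h1 : Real.sqrt (1 + θ ^ 2) ≤ Real.exp (θ ^ 2) := by
      have h2 : Real.sqrt (1 + θ ^ 2) ≤ 1 + θ ^ 2 := by
        rw [Real.sqrt_le_left (by positivity)]
        nlinarith [sq_nonneg θ]
      linarith [Real.add_one_le_exp (θ ^ 2)]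
    calc _ ≤ Real.exp (θ ^ 2) ^ n := by gcongr
      _ = Real.exp (n * θ ^ 2) := (Real.exp_nat_mul _ _).symm
      _ ≤ Real.exp 1 := Real.exp_le_exp.2 hθn
      _ ≤ 3 := by linarith [Real.exp_one_lt_d9]
  -- The distortion constant is `1536 = 3 * 16 * 32`: stretch, loss in the lower bound, and `1 / √θ
  -- = 32 * q`.
  refine ⟨by linarith, laaksoPos θ n, 1 / (32 * q) / (16 * 6 ^ n), by positivity,
    fun u v => ⟨?_, ?_⟩⟩
  · have h := dist_le_dist_laaksoPos hθ hθ1 n u v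
    rw [hsqrt] at h
    rw [div_mul_eq_mul_div, div_le_iff₀ (by positivity)]
    linarith
  · refine (dist_laaksoPos_le hθ.le n u v).trans ?_
    rw [show 1536 * q * (1 / (32 * q) / (16 * 6 ^ n)) = 3 / 6 ^ n by field_simp; norm_num, div_pow]
    gcongr

/-! ### The number of vertices -/

/-- The edges of `G₁` as a sum type. -/
def LaaksoStep.equiv : LaaksoStep ≃ (Unit ⊕ Unit) ⊕ (Bool × Fin 4) where
  toFun
    | first => Sum.inl (Sum.inl ())
    | last => Sum.inl (Sum.inr ())
    | arm b i => Sum.inr (b, i)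
  invFun
    | Sum.inl (Sum.inl ()) => first
    | Sum.inl (Sum.inr ()) => last
    | Sum.inr (b, i) => arm b i
  left_inv s := by cases s <;> rfl
  right_inv s := by rcases s with (_ | _) | _ <;> rfl

/-- The inner vertices of `G₁` as a sum type. -/
def LaaksoInner.equiv : LaaksoInner ≃ (Unit ⊕ Unit) ⊕ (Bool × Fin 3) where
  toFun
    | forkLeft => Sum.inl (Sum.inl ())
    | forkRight => Sum.inl (Sum.inr ())
    | arm b i => Sum.inr (b, i)
  invFun
    | Sum.inl (Sum.inl ()) => forkLeft
    | Sum.inl (Sum.inr ()) => forkRight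
    | Sum.inr (b, i) => arm b i
  left_inv s := by cases s <;> rfl
  right_inv s := by rcases s with (_ | _) | _ <;> rfl

instance : Finite LaaksoStep := Finite.of_equiv _ LaaksoStep.equiv.symm

instance : Finite LaaksoInner := Finite.of_equiv _ LaaksoInner.equiv.symm

theorem card_laaksoStep : Nat.card LaaksoStep = 10 := by
  rw [Nat.card_congr LaaksoStep.equiv]; simp

theorem card_laaksoInner : Nat.card LaaksoInner = 8 := by
  rw [Nat.card_congr LaaksoInner.equiv]; simp

theorem finite_laaksoEdge (n : ℕ) : Finite (laaksoGraph n).E := by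
  induction n with
  | zero => exact inferInstanceAs (Finite Unit)
  | succ n ih => exact inferInstanceAs (Finite ((laaksoGraph n).E × LaaksoStep))

theorem finite_laaksoVertex (n : ℕ) : Finite (laaksoGraph n).V := by
  induction n with
  | zero => exact inferInstanceAs (Finite Bool)
  | succ n ih =>
    have := finite_laaksoEdge n
    exact inferInstanceAs (Finite ((laaksoGraph n).V ⊕ (laaksoGraph n).E × LaaksoInner))

theorem card_laaksoEdge (n : ℕ) : Nat.card (laaksoGraph n).E = 10 ^ n := by
  induction n with
  | zero => exact Nat.card_unique (α := Unit)
  | succ n ih =>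
    change Nat.card ((laaksoGraph n).E × LaaksoStep) = _
    rw [Nat.card_prod, ih, card_laaksoStep, pow_succ]

/-- The inner vertices created by the last substitution suffice. -/
theorem le_card_laaksoVertex (n : ℕ) : 8 * 10 ^ n ≤ Nat.card (LaaksoVertex (n + 1)) := by
  have := finite_laaksoEdge n
  have := finite_laaksoVertex n
  change _ ≤ Nat.card ((laaksoGraph n).V ⊕ (laaksoGraph n).E × LaaksoInner)
  rw [Nat.card_sum, Nat.card_prod, card_laaksoEdge, card_laaksoInner]
  omega

theorem le_log_card_laaksoVertex (n : ℕ) (hn : 1 ≤ n) :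
    (n : ℝ) ≤ Real.log (Nat.card (LaaksoVertex n)) ∧
      2 ≤ Real.log (Nat.card (LaaksoVertex n)) := by
  obtain ⟨n, rfl⟩ := Nat.exists_eq_add_of_le' hn
  have hc : (8 * 10 ^ n : ℝ) ≤ Nat.card (LaaksoVertex (n + 1)) := by
    exact_mod_cast le_card_laaksoVertex n
  have h10 : (1 : ℝ) ≤ 10 ^ n := one_le_pow₀ (by norm_num)
  have he := Real.exp_one_lt_d9
  have he0 := Real.exp_pos 1
  have hpos : (0 : ℝ) < Nat.card (LaaksoVertex (n + 1)) := by linarith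
  rw [Real.le_log_iff_exp_le hpos, Real.le_log_iff_exp_le hpos]
  constructor
  · refine le_trans ?_ hc
    rw [← mul_one ((n + 1 : ℕ) : ℝ), Real.exp_nat_mul, pow_succ, mul_comm]
    gcongr <;> linarith
  -- Since `e² < 8`, the iterated logarithm is at least `log 2 > 0` already for `n = 1`.
  · rw [← mul_one (2 : ℝ), ← Nat.cast_ofNat (n := 2), Real.exp_nat_mul]
    nlinarith

theorem theorem1p2 :
    (∃ C : ℝ, 0 < C ∧ ∀ n : ℕ, 1 ≤ n →
      EmbedsWithDistortion (LaaksoVertex n) Heisenberg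
        (C * (Real.log (Nat.card (LaaksoVertex n))) ^ (1 / 4 : ℝ) *
          Real.sqrt (Real.log (Real.log (Nat.card (LaaksoVertex n)))))) ∧
    (∃ C : ℝ, 0 < C ∧ ∀ n : ℕ, 2 ≤ n →
      EmbedsWithDistortion (LaaksoVertex n) Heisenberg
        (C * (n : ℝ) ^ (1 / 4 : ℝ) * Real.sqrt (Real.log n))) := by
  have hlog2 : 0 < Real.sqrt (Real.log 2) := Real.sqrt_pos.2 (Real.log_pos (by norm_num))
  -- The logarithmic factor is at least `√(log 2)`, so dividing the constant by this number absorbs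
  -- it.
  have key : ∀ (n : ℕ) (a b : ℝ), (n : ℝ) ≤ a → 2 ≤ b →
      1536 * (n : ℝ) ^ (1 / 4 : ℝ) ≤
        1536 / Real.sqrt (Real.log 2) * a ^ (1 / 4 : ℝ) * Real.sqrt (Real.log b) := by
    intro n a b ha hb
    have h0 : (0 : ℝ) ≤ a := (Nat.cast_nonneg n).trans ha
    calc 1536 * (n : ℝ) ^ (1 / 4 : ℝ) = 1536 / Real.sqrt (Real.log 2) * (n : ℝ) ^ (1 / 4 : ℝ) *
          Real.sqrt (Real.log 2) := by field_simp
      _ ≤ _ := by gcongr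
  constructor
  · refine ⟨1536 / Real.sqrt (Real.log 2), by positivity, fun n hn => ?_⟩
    obtain ⟨h1, h2⟩ := le_log_card_laaksoVertex n hn
    exact (embedsWithDistortion_laaksoVertex n hn).mono (key n _ _ h1 h2)
  · refine ⟨1536 / Real.sqrt (Real.log 2), by positivity, fun n hn => ?_⟩
    exact (embedsWithDistortion_laaksoVertex n (by omega)).mono
      (key n _ _ le_rfl (by exact_mod_cast hn))
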